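/- Let $X$ be a complex Hilbert space, let $(B,D(B))$ be the generator of a strongly continuous semigroup $(S(t))_{t\ge 0}$ on $X$, and let $C\in\mathcal L(X)$ commute with $(B,D(B))$, i.e. $C\,D(B)\subseteq D(B)$ and $BCx=CBx$ for all $x\in D(B)$. For the generator $G$ of a strongly continuous semigroup $(T(t))_{t\ge 0}$ let $$\omega_0(G):=\inf\{\omega\in\mathbb R:\ \exists M\ \forall t\ge 0\ \ \|T(t)\|\le Me^{\omega t}\}\in[-\infty,\infty)$$ be the growth bound of the semigroup. Let $\Phi:=C\delta_{-1}:W^{1,2}([-1,0],X)\to X$, $\Phi f:=Cf(-1)$, and on the Hilbert space $\mathcal E:=X\times L^2([-1,0],X)$ consider the operator $$\mathcal A\binom{x}{f}:=\binom{Bx+\Phi f}{f'},\qquad D(\mathcal A):=\Big\{\binom{x}{f}\in D(B)\times W^{1,2}([-1,0],X):\ f(0)=x\Big\},$$ associated with the delay equation $u'(t)=Bu(t)+Cu(t-1)$. Assume that $\omega_0(B)<0$ and that $$r(C)<\frac1{\sup_{\omega\in\mathbb R}\|R(i\omega,B)\|},$$ where $r(C)$ is the spectral radius of $C$ and $R(\lambda,B)=(\lambda-B)^{-1}$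 (with $1/0:=\infty$, which is relevant only for $X=\{0\}$). Then $\mathcal A$ generates a strongly continuous semigroup on $\mathcal E$, and $\omega_0(\mathcal A)<0$. -/

import Mathlib

open MeasureTheory Set Filter Topology
open scoped ENNReal NNReal

noncomputable section

namespace DelayEq

/-! ### Strongly continuous semigroups, generators, growth bounds, resolvents -/

section Semigroup

/-- A strongly continuous semigroup of bounded linear operators on `X`. -/
structure C0Semigroup (X : Type*) [NormedAddCommGroup X] [NormedSpace ℂ X] where
  toFun : ℝ≥0 → X →L[ℂ] X
  map_zero' : toFun 0 = ContinuousLinearMap.id ℂ X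
  map_add' : ∀ s t, toFun (s + t) = (toFun s).comp (toFun t)
  continuous_orbit' : ∀ x, Continuous fun t => toFun t x

variable {X : Type*} [NormedAddCommGroup X] [NormedSpace ℂ X]

/-- The difference quotient of the orbit of `x` at time `0` converges to `y`. -/
def C0Semigroup.HasGenValue (S : C0Semigroup X) (x y : X) : Prop :=
  Tendsto (fun h : ℝ≥0 => ((h : ℝ) : ℂ)⁻¹ • (S.toFun h x - x)) (𝓝[>] 0) (𝓝 y)

theorem C0Semigroup.HasGenValue.add {S : C0Semigroup X} {x x' y y' : X}
    (h : S.HasGenValue x y) (h' : S.HasGenValue x' y') :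
    S.HasGenValue (x + x') (y + y') := by
  refine (Tendsto.add h h').congr fun t => ?_
  rw [← smul_add, map_add]
  congr 1
  abel

theorem C0Semigroup.HasGenValue.smul {S : C0Semigroup X} {x y : X} (c : ℂ)
    (h : S.HasGenValue x y) : S.HasGenValue (c • x) (c • y) := by
  refine (Tendsto.const_smul h c).congr fun t => ?_
  rw [smul_comm, smul_sub, map_smul]

theorem C0Semigroup.HasGenValue.unique {S : C0Semigroup X} {x y y' : X}
    (h : S.HasGenValue x y) (h' : S.HasGenValue x y') : y = y' :=
  tendsto_nhds_unique h h'

/-- The infinitesimal generator of a strongly continuous semigroup, with its maximal domain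
`{x | lim_{h ↓ 0} (S(h)x - x) / h exists}`. -/
def C0Semigroup.generator (S : C0Semigroup X) : X →ₗ.[ℂ] X where
  domain :=
    { carrier := {x | ∃ y, S.HasGenValue x y}
      add_mem' := fun ⟨y, h⟩ ⟨y', h'⟩ => ⟨y + y', h.add h'⟩
      zero_mem' := ⟨0, by simp [C0Semigroup.HasGenValue]⟩
      smul_mem' := fun c _ ⟨y, h⟩ => ⟨c • y, h.smul c⟩ }
  toFun :=
    { toFun := fun x => x.2.choose
      map_add' := fun x x' =>
        (x + x').2.choose_spec.unique (x.2.choose_spec.add x'.2.choose_spec)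
      map_smul' := fun c x => (c • x).2.choose_spec.unique (x.2.choose_spec.smul c) }

/-- The growth bound
`ω₀ = inf {ω ∈ ℝ | ∃ M, ‖S(t)‖ ≤ M e^{ω t} for all t ≥ 0}`; it may be `-∞`. -/
def C0Semigroup.growthBound (S : C0Semigroup X) : EReal :=
  sInf {w : EReal | ∃ ω : ℝ, w = (ω : EReal) ∧
    ∃ M : ℝ, ∀ t : ℝ≥0, ‖S.toFun t‖ ≤ M * Real.exp (ω * t)}

/-- The bounded operator `R` is a two-sided inverse of `z - B : D(B) → X`. -/
def IsResolventAt (B : X →ₗ.[ℂ] X) (z : ℂ) (R : X →L[ℂ] X) : Prop :=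
  (∀ x : X, ∃ h : R x ∈ B.domain, z • R x - B ⟨R x, h⟩ = x) ∧
    ∀ x : B.domain, R (z • (x : X) - B x) = x

open scoped Classical in
/-- The resolvent `R(z, B) = (z - B)⁻¹` for `z` in the resolvent set of `B`
(and `0` for all other `z`). -/
def resolventOp (B : X →ₗ.[ℂ] X) (z : ℂ) : X →L[ℂ] X :=
  if h : ∃ R, IsResolventAt B z R then h.choose else 0

/-- The bounded operator `C` commutes with `(B, D(B))`: `C` maps `D(B)` into itself and
`B C x = C B x` for `x ∈ D(B)`. -/
def CommutesWith (C : X →L[ℂ] X) (B : X →ₗ.[ℂ] X) : Prop :=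
  ∀ x : B.domain, ∃ h : C x ∈ B.domain, B ⟨C x, h⟩ = C (B x)

end Semigroup

/-! ### The Sobolev space `W^{1,2}([-1,0], X)` -/

section Sobolev

open scoped ContDiff

/-- Lebesgue measure on `[-1,0]`. -/
abbrev histMeasure : Measure ℝ := volume.restrict (Icc (-1) 0)

/-- The space `L²([-1,0], X)`. -/
abbrev HistL2 (X : Type*) [NormedAddCommGroup X] : Type _ := Lp X 2 histMeasure

variable {X : Type*} [NormedAddCommGroup X] [NormedSpace ℂ X]

/-- `g` is a weak derivative of `f` on `(-1,0)`. -/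
def IsWeakDeriv (f g : HistL2 X) : Prop :=
  ∀ φ : ℝ → ℝ, ContDiff ℝ ∞ φ → HasCompactSupport φ → tsupport φ ⊆ Ioo (-1) 0 →
    ∫ σ in Icc (-1 : ℝ) 0, deriv φ σ • f σ = -∫ σ in Icc (-1 : ℝ) 0, φ σ • g σ

theorem integrable_histL2 {X : Type*} [NormedAddCommGroup X] (f : HistL2 X) : Integrable f histMeasure :=
  (Lp.memLp f).integrable (by norm_num)

theorem integrable_smul_histL2 {φ : ℝ → ℝ} (hφ : Continuous φ) (f : HistL2 X) :
    Integrable (fun σ => φ σ • f σ) histMeasure := by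
  have h : IntegrableOn (fun σ => φ σ • f σ) (Icc (-1) 0) volume :=
    IntegrableOn.continuousOn_smul (integrable_histL2 f) hφ.continuousOn isCompact_Icc
  exact h

theorem IsWeakDeriv.add {f g f' g' : HistL2 X} (h : IsWeakDeriv f g) (h' : IsWeakDeriv f' g') :
    IsWeakDeriv (f + f') (g + g') := by
  intro φ hφ hc hs
  have hd : Continuous (deriv φ) := hφ.continuous_deriv (by simp)
  have e1 : ∫ σ in Icc (-1 : ℝ) 0, deriv φ σ • (f + f') σ =
      ∫ σ in Icc (-1 : ℝ) 0, (deriv φ σ • f σ + deriv φ σ • f' σ) := by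
    refine integral_congr_ae ?_
    filter_upwards [Lp.coeFn_add f f'] with σ hσ
    rw [hσ, Pi.add_apply, smul_add]
  have e2 : ∫ σ in Icc (-1 : ℝ) 0, φ σ • (g + g') σ =
      ∫ σ in Icc (-1 : ℝ) 0, (φ σ • g σ + φ σ • g' σ) := by
    refine integral_congr_ae ?_
    filter_upwards [Lp.coeFn_add g g'] with σ hσ
    rw [hσ, Pi.add_apply, smul_add]
  rw [e1, e2, integral_add (integrable_smul_histL2 hd f) (integrable_smul_histL2 hd f'),
    integral_add (integrable_smul_histL2 hφ.continuous g)
      (integrable_smul_histL2 hφ.continuous g'), h φ hφ hc hs, h' φ hφ hc hs, neg_add]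

theorem IsWeakDeriv.smul {f g : HistL2 X} (c : ℂ) (h : IsWeakDeriv f g) :
    IsWeakDeriv (c • f) (c • g) := by
  intro φ hφ hc hs
  have e1 : ∫ σ in Icc (-1 : ℝ) 0, deriv φ σ • (c • f) σ =
      ∫ σ in Icc (-1 : ℝ) 0, c • (deriv φ σ • f σ) := by
    refine integral_congr_ae ?_
    filter_upwards [Lp.coeFn_smul c f] with σ hσ
    rw [hσ, Pi.smul_apply, smul_comm]
  have e2 : ∫ σ in Icc (-1 : ℝ) 0, φ σ • (c • g) σ =
      ∫ σ in Icc (-1 : ℝ) 0, c • (φ σ • g σ) := by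
    refine integral_congr_ae ?_
    filter_upwards [Lp.coeFn_smul c g] with σ hσ
    rw [hσ, Pi.smul_apply, smul_comm]
  rw [e1, e2, integral_smul, integral_smul, h φ hφ hc hs, smul_neg]

theorem isWeakDeriv_zero : IsWeakDeriv (0 : HistL2 X) 0 := by
  have h : (((0 : HistL2 X) : ℝ → X)) =ᵐ[histMeasure] 0 := Lp.coeFn_zero _ _ _
  intro φ _ _ _
  rw [integral_eq_zero_of_ae, integral_eq_zero_of_ae, neg_zero]
  · filter_upwards [h] with σ hσ
    rw [hσ, Pi.zero_apply, smul_zero]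
  · filter_upwards [h] with σ hσ
    rw [hσ, Pi.zero_apply, smul_zero]

variable [CompleteSpace X]

/-- A function integrable on `[-1,0]` that vanishes against all test functions vanishes a.e. -/
theorem ae_eq_zero_of_test {h : ℝ → X} (hi : Integrable h histMeasure)
    (H : ∀ φ : ℝ → ℝ, ContDiff ℝ ∞ φ → HasCompactSupport φ → tsupport φ ⊆ Ioo (-1) 0 →
      ∫ σ in Icc (-1 : ℝ) 0, φ σ • h σ = 0) : h =ᵐ[histMeasure] 0 := by
  have hi' : IntegrableOn h (Ioo (-1) 0) volume :=
    IntegrableOn.mono_set (t := Icc (-1) 0) hi Ioo_subset_Icc_self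
  have key := isOpen_Ioo.ae_eq_zero_of_integral_contDiff_smul_eq_zero (U := Ioo (-1 : ℝ) 0)
    (μ := volume) hi'.locallyIntegrableOn (fun φ h1 h2 h3 => by
      rw [← H φ h1 h2 h3]
      refine (setIntegral_eq_integral_of_forall_compl_eq_zero fun x hx => ?_).symm
      have : φ x = 0 := by
        by_contra h0
        exact hx (Ioo_subset_Icc_self (h3 (subset_tsupport φ h0)))
      rw [this, zero_smul])
  have : h =ᵐ[volume.restrict (Ioo (-1) 0)] 0 :=
    (ae_restrict_iff' measurableSet_Ioo).2 key
  rwa [restrict_Ioo_eq_restrict_Icc] at this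

theorem IsWeakDeriv.unique {f g g' : HistL2 X} (h : IsWeakDeriv f g) (h' : IsWeakDeriv f g') :
    g = g' := by
  have h0 : ((g : ℝ → X) - (g' : ℝ → X)) =ᵐ[histMeasure] 0 := by
    refine ae_eq_zero_of_test ((integrable_histL2 g).sub (integrable_histL2 g')) ?_
    intro φ hφ hc hs
    have := neg_injective ((h φ hφ hc hs).symm.trans (h' φ hφ hc hs))
    simp only [Pi.sub_apply, smul_sub]
    rw [integral_sub (integrable_smul_histL2 hφ.continuous g)
      (integrable_smul_histL2 hφ.continuous g'), this, sub_self]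
  refine Lp.ext ?_
  filter_upwards [h0] with σ hσ
  exact sub_eq_zero.1 hσ

theorem primitive_eq {X : Type*} [NormedAddCommGroup X] [NormedSpace ℝ X] {g : ℝ → X} {σ : ℝ} (hσ : σ ∈ Icc (-1 : ℝ) 0) :
    ∫ s in (-1)..σ, g s = ∫ s, (Iic σ).indicator g s ∂histMeasure := by
  rw [intervalIntegral.integral_of_le hσ.1, integral_indicator measurableSet_Iic,
    Measure.restrict_restrict measurableSet_Iic]
  have : Iic σ ∩ Icc (-1) 0 = Icc (-1) σ := by
    ext s
    simp only [mem_inter_iff, mem_Iic, mem_Icc]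
    constructor
    · rintro ⟨h1, h2, -⟩
      exact ⟨h2, h1⟩
    · rintro ⟨h1, h2⟩
      exact ⟨h2, h1, h2.trans hσ.2⟩
  rw [this, integral_Icc_eq_integral_Ioc]

theorem integral_deriv_Ici {φ : ℝ → ℝ} (hφ : ContDiff ℝ ∞ φ)
    (hs : tsupport φ ⊆ Ioo (-1) 0) {s : ℝ} (hσ : s ∈ Icc (-1 : ℝ) 0) :
    ∫ σ, (Ici s).indicator (deriv φ) σ ∂histMeasure = -φ s := by
  have hd : Continuous (deriv φ) := hφ.continuous_deriv (by simp)
  have h0 : φ 0 = 0 := by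
    by_contra h0
    exact absurd (hs (subset_tsupport φ h0)).2 (lt_irrefl _)
  rw [integral_indicator measurableSet_Ici, Measure.restrict_restrict measurableSet_Ici]
  have : Ici s ∩ Icc (-1) 0 = Icc s 0 := by
    ext t
    simp only [mem_inter_iff, mem_Ici, mem_Icc]
    constructor
    · rintro ⟨h1, -, h2⟩
      exact ⟨h1, h2⟩
    · rintro ⟨h1, h2⟩
      exact ⟨h1, hσ.1.trans h1, h2⟩
  rw [this, integral_Icc_eq_integral_Ioc, ← intervalIntegral.integral_of_le hσ.2,
    intervalIntegral.integral_deriv_eq_sub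
      (fun x _ => (hφ.differentiable (by simp)).differentiableAt)
      (hd.intervalIntegrable _ _), h0, zero_sub]

/-- Integration by parts of a test function against a primitive. -/
theorem integral_deriv_smul_primitive {g : ℝ → X} (hg : Integrable g histMeasure) {φ : ℝ → ℝ}
    (hφ : ContDiff ℝ ∞ φ) (hs : tsupport φ ⊆ Ioo (-1) 0) :
    ∫ σ in Icc (-1 : ℝ) 0, deriv φ σ • (∫ s in (-1)..σ, g s) =
      -∫ σ in Icc (-1 : ℝ) 0, φ σ • g σ := by
  have hd : Continuous (deriv φ) := hφ.continuous_deriv (by simp)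
  have hdi : Integrable (deriv φ) histMeasure := hd.continuousOn.integrableOn_Icc
  have hF : Integrable ({p : ℝ × ℝ | p.2 ≤ p.1}.indicator fun p => deriv φ p.1 • g p.2)
      (histMeasure.prod histMeasure) :=
    (Integrable.smul_prod hdi hg).indicator
      (measurableSet_le measurable_snd measurable_fst)
  have h1 : ∫ σ in Icc (-1 : ℝ) 0, deriv φ σ • (∫ s in (-1)..σ, g s) =
      ∫ σ, ∫ s, {p : ℝ × ℝ | p.2 ≤ p.1}.indicator (fun p => deriv φ p.1 • g p.2) (σ, s)
        ∂histMeasure ∂histMeasure := by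
    refine setIntegral_congr_fun measurableSet_Icc fun σ hσ => ?_
    rw [primitive_eq hσ, ← integral_smul]
    refine integral_congr_ae (Eventually.of_forall fun s => ?_)
    by_cases h : s ≤ σ <;> simp [indicator, h]
  rw [h1, integral_integral_swap
    (f := fun σ s => {p : ℝ × ℝ | p.2 ≤ p.1}.indicator (fun p => deriv φ p.1 • g p.2) (σ, s)) hF, ← integral_neg]
  refine setIntegral_congr_fun measurableSet_Icc fun s hs' => ?_
  rw [← neg_smul, ← integral_deriv_Ici hφ hs hs', ← integral_smul_const]
  refine integral_congr_ae (Eventually.of_forall fun σ => ?_)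
  by_cases h : s ≤ σ <;> simp [indicator, h]

theorem continuousOn_primitive_hist {X : Type*} [NormedAddCommGroup X] [NormedSpace ℝ X]
    {g : ℝ → X} (hg : Integrable g histMeasure) :
    ContinuousOn (fun σ => ∫ s in (-1)..σ, g s) (Icc (-1) 0) := by
  have h : IntegrableOn g (uIcc (-1) 0) volume := by
    rw [uIcc_of_le (by norm_num)]
    exact hg
  have := intervalIntegral.continuousOn_primitive_interval h
  rwa [uIcc_of_le (by norm_num)] at this

/-- The primitive of a test function with vanishing integral is a test function. -/
theorem exists_test_primitive {χ : ℝ → ℝ} (hχ : ContDiff ℝ ∞ χ) (hc : HasCompactSupport χ)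
    (hs : tsupport χ ⊆ Ioo (-1) 0) (h0 : ∫ s in (-1)..0, χ s = 0) :
    ∃ φ : ℝ → ℝ, ContDiff ℝ ∞ φ ∧ HasCompactSupport φ ∧ tsupport φ ⊆ Ioo (-1) 0 ∧
      deriv φ = χ := by
  have hder : ∀ x, HasDerivAt (fun x => ∫ s in (-1)..x, χ s) (χ x) x := fun x =>
    (hχ.continuous.integral_hasStrictDerivAt (-1) x).hasDerivAt
  have hderiv : deriv (fun x => ∫ s in (-1)..x, χ s) = χ := funext fun x => (hder x).deriv
  obtain ⟨a, b, ha, hb, hab⟩ : ∃ a b : ℝ, -1 < a ∧ b < 0 ∧ tsupport χ ⊆ Icc a b := by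
    rcases (tsupport χ).eq_empty_or_nonempty with he | hne
    · exact ⟨-1 / 2, -1 / 2, by norm_num, by norm_num, by simp [he]⟩
    · have hK : IsCompact (tsupport χ) := hc
      exact ⟨sInf (tsupport χ), sSup (tsupport χ), (hs (hK.sInf_mem hne)).1,
        (hs (hK.sSup_mem hne)).2,
        fun x hx => ⟨csInf_le hK.bddBelow hx, le_csSup hK.bddAbove hx⟩⟩
  have hz : ∀ x, x ∉ Icc a b → χ x = 0 := fun x hx => by
    by_contra h
    exact hx (hab (subset_tsupport χ h))
  have hsupp : Function.support (fun x => ∫ s in (-1)..x, χ s) ⊆ Icc a b := by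
    intro x hx
    by_contra hn
    refine hx ?_
    rcases lt_or_ge x a with hxa | hxa
    · refine intervalIntegral.integral_zero_ae (Eventually.of_forall fun t ht => hz t ?_)
      intro h
      rcases le_total (-1) x with h1 | h1
      · rw [uIoc_of_le h1] at ht
        exact absurd (ht.2.trans_lt hxa) (not_lt.2 h.1)
      · rw [uIoc_of_ge h1] at ht
        exact absurd (ht.2.trans_lt ha) (not_lt.2 h.1)
    · have hxb : b < x := by
        by_contra h
        exact hn ⟨hxa, not_lt.1 h⟩
      have e : ∫ s in x..0, χ s = 0 := by
        refine intervalIntegral.integral_zero_ae (Eventually.of_forall fun t ht => hz t ?_)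
        intro h
        rcases le_total x 0 with h1 | h1
        · rw [uIoc_of_le h1] at ht
          exact absurd (hxb.trans ht.1) (not_lt.2 h.2)
        · rw [uIoc_of_ge h1] at ht
          exact absurd (hb.trans ht.1) (not_lt.2 h.2)
      have := intervalIntegral.integral_add_adjacent_intervals
        (hχ.continuous.intervalIntegrable (μ := volume) (-1) x)
        (hχ.continuous.intervalIntegrable (μ := volume) x 0)
      rw [e, h0, add_zero] at this
      exact this
  have htsupp : tsupport (fun x => ∫ s in (-1)..x, χ s) ⊆ Icc a b :=
    closure_minimal hsupp isClosed_Icc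
  refine ⟨fun x => ∫ s in (-1)..x, χ s, ?_, ?_, ?_, hderiv⟩
  · rw [contDiff_infty_iff_deriv, hderiv]
    exact ⟨fun x => (hder x).differentiableAt, hχ⟩
  · exact isCompact_Icc.of_isClosed_subset (isClosed_tsupport _) htsupp
  · exact htsupp.trans (Icc_subset_Ioo ha hb)

/-- There is a test function on `(-1,0)` with integral one. -/
theorem exists_test_one : ∃ η : ℝ → ℝ, ContDiff ℝ ∞ η ∧ HasCompactSupport η ∧
    tsupport η ⊆ Ioo (-1) 0 ∧ ∫ s in Icc (-1 : ℝ) 0, η s = 1 := by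
  let b : ContDiffBump (-1 / 2 : ℝ) := ⟨1 / 8, 1 / 4, by norm_num, by norm_num⟩
  have hsub : tsupport (b.normed volume) ⊆ Ioo (-1) 0 := by
    rw [b.tsupport_normed_eq, Real.closedBall_eq_Icc]
    exact Icc_subset_Ioo (by norm_num [b]) (by norm_num [b])
  refine ⟨b.normed volume, b.contDiff_normed, b.hasCompactSupport_normed, hsub, ?_⟩
  rw [setIntegral_eq_integral_of_forall_compl_eq_zero, b.integral_normed]
  intro x hx
  by_contra h
  exact hx (Ioo_subset_Icc_self (hsub (subset_tsupport _ h)))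

/-- An element of `L²` with a weak derivative in `L²` is a.e. equal to a constant plus the
primitive of its weak derivative. -/
theorem IsWeakDeriv.exists_primitive {f g : HistL2 X} (h : IsWeakDeriv f g) :
    ∃ c : X, (f : ℝ → X) =ᵐ[histMeasure] fun σ => c + ∫ s in (-1)..σ, g s := by
  obtain ⟨η, hη, hηc, hηs, hη1⟩ := exists_test_one
  have hgi := integrable_histL2 g
  have hPi : Integrable (fun σ => ∫ s in (-1)..σ, g s) histMeasure :=
    (continuousOn_primitive_hist hgi).integrableOn_Icc
  set u : ℝ → X := fun σ => f σ - ∫ s in (-1)..σ, g s with hu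
  have hui : Integrable u histMeasure := (integrable_histL2 f).sub hPi
  have hsm : ∀ {φ : ℝ → ℝ} {v : ℝ → X}, Continuous φ → Integrable v histMeasure →
      Integrable (fun σ => φ σ • v σ) histMeasure := fun {φ v} hφ hv => by
    have h : IntegrableOn (fun σ => φ σ • v σ) (Icc (-1) 0) volume :=
      IntegrableOn.continuousOn_smul hv hφ.continuousOn isCompact_Icc
    exact h
  have hzero : ∀ φ : ℝ → ℝ, ContDiff ℝ ∞ φ → HasCompactSupport φ → tsupport φ ⊆ Ioo (-1) 0 →
      ∫ σ in Icc (-1 : ℝ) 0, deriv φ σ • u σ = 0 := fun φ hφ hc hs => by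
    have hd : Continuous (deriv φ) := hφ.continuous_deriv (by simp)
    simp only [hu, smul_sub]
    rw [integral_sub (hsm hd (integrable_histL2 f)) (hsm hd hPi), h φ hφ hc hs,
      integral_deriv_smul_primitive hgi hφ hs, sub_self]
  refine ⟨∫ σ in Icc (-1 : ℝ) 0, η σ • u σ, ?_⟩
  have key : (fun σ => u σ - ∫ σ in Icc (-1 : ℝ) 0, η σ • u σ) =ᵐ[histMeasure] 0 := by
    refine ae_eq_zero_of_test (hui.sub (integrable_const _)) fun ψ hψ hψc hψs => ?_
    set m : ℝ := ∫ s in Icc (-1 : ℝ) 0, ψ s with hm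
    have hχ : ContDiff ℝ ∞ (fun s => ψ s - m * η s) := hψ.sub (contDiff_const.mul hη)
    have hχ' : tsupport (fun s => ψ s - m * η s) ⊆ tsupport ψ ∪ tsupport η := by
      refine closure_minimal ?_ ((isClosed_tsupport _).union (isClosed_tsupport _))
      intro x hx
      by_contra hn
      rw [mem_union, not_or] at hn
      exact hx (by simp [image_eq_zero_of_notMem_tsupport hn.1,
        image_eq_zero_of_notMem_tsupport hn.2])
    have hψi : Integrable ψ histMeasure := hψ.continuous.continuousOn.integrableOn_Icc
    have hηi : Integrable η histMeasure := hη.continuous.continuousOn.integrableOn_Icc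
    obtain ⟨φ, hφ, hφc, hφs, hφd⟩ := exists_test_primitive hχ
      ((hψc.isCompact.union hηc.isCompact).of_isClosed_subset (isClosed_tsupport _) hχ')
      (hχ'.trans (union_subset hψs hηs)) (by
        rw [intervalIntegral.integral_of_le (by norm_num), ← integral_Icc_eq_integral_Ioc,
          integral_sub hψi (hηi.const_mul m), integral_const_mul, hη1, mul_one, sub_self])
    have hz := hzero φ hφ hφc hφs
    rw [hφd] at hz
    simp only [sub_smul, mul_smul] at hz
    have hmi : Integrable (fun σ => m • η σ • u σ) histMeasure :=
      (hsm hη.continuous hui).smul m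
    rw [integral_sub (hsm hψ.continuous hui) hmi, integral_smul] at hz
    simp only [smul_sub]
    rw [integral_sub (hsm hψ.continuous hui) (hψi.smul_const _), integral_smul_const]
    exact hz
  filter_upwards [key] with σ hσ
  have := sub_eq_zero.1 hσ
  simp only [hu] at this
  rw [← this, sub_add_cancel]

variable (X) in
/-- The Sobolev space `W^{1,2}([-1,0], X)`: elements of `L²` with a weak derivative in `L²`. -/
def W12 : Submodule ℂ (HistL2 X) where
  carrier := {f | ∃ g, IsWeakDeriv f g}
  add_mem' := fun ⟨g, h⟩ ⟨g', h'⟩ => ⟨g + g', h.add h'⟩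
  zero_mem' := ⟨0, isWeakDeriv_zero⟩
  smul_mem' := fun c _ ⟨g, h⟩ => ⟨c • g, h.smul c⟩

/-- The derivative `d/dσ : W^{1,2}([-1,0], X) → L²([-1,0], X)`. -/
def weakDeriv : W12 X →ₗ[ℂ] HistL2 X where
  toFun f := f.2.choose
  map_add' f f' := (f + f').2.choose_spec.unique (f.2.choose_spec.add f'.2.choose_spec)
  map_smul' c f := (c • f).2.choose_spec.unique (f.2.choose_spec.smul c)

/-- `u` is a continuous representative of `f` on `[-1,0]`. -/
def IsContRep {X : Type*} [NormedAddCommGroup X] (f : HistL2 X) (u : ℝ → X) : Prop :=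
  ContinuousOn u (Icc (-1) 0) ∧ (f : ℝ → X) =ᵐ[histMeasure] u

theorem IsContRep.eqOn {X : Type*} [NormedAddCommGroup X] {f : HistL2 X} {u v : ℝ → X}
    (hu : IsContRep f u) (hv : IsContRep f v) : EqOn u v (Icc (-1) 0) :=
  Measure.eqOn_Icc_of_ae_eq volume (by norm_num) (hu.2.symm.trans hv.2) hu.1 hv.1

theorem exists_isContRep (f : W12 X) : ∃ u, IsContRep (f : HistL2 X) u := by
  obtain ⟨g, hg⟩ := f.2
  obtain ⟨c, hc⟩ := hg.exists_primitive
  exact ⟨_, continuousOn_const.add (continuousOn_primitive_hist (integrable_histL2 g)), hc⟩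

/-- The point evaluation `δ_σ : W^{1,2}([-1,0], X) → X`, i.e. the value at `σ` of the continuous
representative. -/
def pointEval (σ : Icc (-1 : ℝ) 0) : W12 X →ₗ[ℂ] X where
  toFun f := (exists_isContRep f).choose σ
  map_add' f f' := by
    have h := (exists_isContRep f).choose_spec
    have h' := (exists_isContRep f').choose_spec
    exact (exists_isContRep (f + f')).choose_spec.eqOn
      ⟨h.1.add h'.1, (Lp.coeFn_add _ _).trans (h.2.add h'.2)⟩ σ.2
  map_smul' c f := by
    have h := (exists_isContRep f).choose_spec
    exact (exists_isContRep (c • f)).choose_spec.eqOn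
      ⟨h.1.const_smul c, (Lp.coeFn_smul _ _).trans (h.2.const_smul c)⟩ σ.2

end Sobolev

/-! ### The delay operator matrix -/

section Delay

/-- The product space `X × L²([-1,0], X)` with the `2`-norm. -/
abbrev DelaySpace (X : Type*) [NormedAddCommGroup X] : Type _ := WithLp 2 (X × HistL2 X)

variable {X : Type*} [NormedAddCommGroup X] [NormedSpace ℂ X] [CompleteSpace X]

/-- The domain `{(x, f) ∈ D(B) × W^{1,2}([-1,0], X) | f(0) = x}`. -/
def delayDomain (B : X →ₗ.[ℂ] X) : Submodule ℂ (DelaySpace X) where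
  carrier := {v | v.fst ∈ B.domain ∧
    ∃ h : v.snd ∈ W12 X, pointEval ⟨0, by norm_num⟩ ⟨v.snd, h⟩ = v.fst}
  add_mem' := fun {v w} ⟨hv, hv', ev⟩ ⟨hw, hw', ew⟩ =>
    ⟨B.domain.add_mem hv hw, (W12 X).add_mem hv' hw',
      ((pointEval ⟨0, by norm_num⟩).map_add ⟨v.snd, hv'⟩ ⟨w.snd, hw'⟩).trans
        (congrArg₂ (· + ·) ev ew)⟩
  zero_mem' := ⟨B.domain.zero_mem, (W12 X).zero_mem, (pointEval ⟨0, by norm_num⟩).map_zero⟩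
  smul_mem' := fun c v ⟨hv, hv', ev⟩ =>
    ⟨B.domain.smul_mem c hv, (W12 X).smul_mem c hv',
      ((pointEval ⟨0, by norm_num⟩).map_smul c ⟨v.snd, hv'⟩).trans
        (congrArg (c • ·) ev)⟩

/-- The first component of an element of the domain, as an element of `D(B)`. -/
def delayFst (B : X →ₗ.[ℂ] X) : delayDomain B →ₗ[ℂ] B.domain where
  toFun v := ⟨(v : DelaySpace X).fst, v.2.1⟩
  map_add' _ _ := rfl
  map_smul' _ _ := rfl

/-- The second component of an element of the domain, as an element of `W^{1,2}`. -/
def delaySnd (B : X →ₗ.[ℂ] X) : delayDomain B →ₗ[ℂ] W12 X where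
  toFun v := ⟨(v : DelaySpace X).snd, v.2.2.1⟩
  map_add' _ _ := rfl
  map_smul' _ _ := rfl

/-- The operator `(x, f) ↦ (B x + Φ f, f')` with domain
`{(x, f) ∈ D(B) × W^{1,2}([-1,0], X) | f(0) = x}`. -/
def delayOperator (B : X →ₗ.[ℂ] X) (Φ : W12 X →ₗ[ℂ] X) :
    DelaySpace X →ₗ.[ℂ] DelaySpace X where
  domain := delayDomain B
  toFun := (WithLp.linearEquiv 2 ℂ (X × HistL2 X)).symm.toLinearMap ∘ₗ
    LinearMap.prod (B.toFun ∘ₗ delayFst B + Φ ∘ₗ delaySnd B) (weakDeriv ∘ₗ delaySnd B)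

theorem delayOperator_apply (B : X →ₗ.[ℂ] X) (Φ : W12 X →ₗ[ℂ] X) (v : delayDomain B) :
    delayOperator B Φ v =
      WithLp.toLp 2 (B (delayFst B v) + Φ (delaySnd B v), weakDeriv (delaySnd B v)) :=
  rfl

/-- The point delay `Φ = C δ_{-1}`. -/
def pointDelay (C : X →L[ℂ] X) : W12 X →ₗ[ℂ] X :=
  (C : X →ₗ[ℂ] X).comp (pointEval ⟨-1, by norm_num⟩)

end Delay

end DelayEq

end

/-! The delay equation is solved once and for all on the whole half line, in `L²`; stability is then
read off from square integrability. Extend a solution with data `v = (x, f)` by zero before time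
`-1`. Variation of constants says that the resulting function `W` on the line satisfies `W = J v + L
W`. Here `J v` is the history `f` followed by the free orbit `S(t)x`, and `L = K C τ`, where `τ` is
the delay by one, `C` acts pointwise and `K` is causal convolution with `S`. Exponential stability
of `S` makes `J` bounded into `L²(ℝ, X)`.

Plancherel's theorem, which is where the Hilbert space structure enters, turns `K` into
multiplication by the resolvent of `B` on the imaginary axis, so `‖K‖ ≤ m` with `m` the supremum of
the resolvent norms (`exists_convOp`). As `C` commutes with `B`, it commutes with the semigroup
(`CommutesWith.op_comm`). Hence `K`, `C` and the isometry `τ` commute pairwise and `‖L^n‖ ≤ m^n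
‖C^n‖` for `n > 0`. By Gelfand's formula the Neumann series converges when `r(C) m < 1`
(`summable_delay_pow`), so each `v` has exactly one trajectory in `L²(ℝ, X)`, depending boundedly on
`v` (`exists_trajectory`).

Uniqueness makes the pairs (present value, history segment) a semigroup (`exists_delaySemigroup`).
Its orbits are square integrable with a bound `c ‖v‖²`, and Datko's criterion gives a negative
growth bound (`growthBound_delaySemigroup_neg`).

It remains to identify the generator. Differentiating orbits at zero shows that it is contained in
the delay operator (`hasGenValue_delaySemigroup`). For equality it is enough that `l` minus the
generator is onto and `l` minus the delay operator is injective for one `l > 0`. An eigenvector has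
history `e^{lσ} x` with `x = R(l, B) C e^{-l} x`, which forces `x = 0` for large `l`
(`delayOperator_injective`). -/

noncomputable section

namespace DelayEq

/-! ### Elementary semigroup theory -/

namespace C0Semigroup

section Basic

variable {X : Type*} [NormedAddCommGroup X] [NormedSpace ℂ X] (S : C0Semigroup X)

/-- The semigroup indexed by real numbers, constant for negative times. -/
def op (t : ℝ) : X →L[ℂ] X := S.toFun t.toNNReal

theorem toFun_eq_op (t : ℝ≥0) : S.toFun t = S.op t := by simp [op]

theorem op_zero : S.op 0 = ContinuousLinearMap.id ℂ X := by
  simpa [op] using S.map_zero'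

theorem op_zero_apply (x : X) : S.op 0 x = x := by simp [op_zero]

theorem op_add {s t : ℝ} (hs : 0 ≤ s) (ht : 0 ≤ t) (x : X) :
    S.op (s + t) x = S.op s (S.op t x) := by
  simp [op, Real.toNNReal_add hs ht, S.map_add']

theorem op_comm {s t : ℝ} (hs : 0 ≤ s) (ht : 0 ≤ t) (x : X) :
    S.op s (S.op t x) = S.op t (S.op s x) := by
  rw [← S.op_add hs ht, ← S.op_add ht hs, add_comm]

theorem continuous_op_apply (x : X) : Continuous fun t => S.op t x :=
  (S.continuous_orbit' x).comp continuous_real_toNNReal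

theorem op_max (t : ℝ) : S.op (max t 0) = S.op t := by
  rcases le_total t 0 with h | h <;> simp [op, h, Real.toNNReal_of_nonpos]

/-- Banach–Steinhaus on the compact interval `[0, max b 0]`; `op` is constant on negative times, so
these need no separate bound. -/
theorem exists_norm_op_le [CompleteSpace X] (b : ℝ) : ∃ M : ℝ, 0 ≤ M ∧ ∀ t ≤ b, ‖S.op t‖ ≤ M := by
  obtain ⟨M, hM⟩ := banach_steinhaus (g := fun t : Icc (0 : ℝ) (max b 0) => S.op t) fun x => by
    obtain ⟨c, hc⟩ := isCompact_Icc.exists_bound_of_continuousOn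
      (s := Icc (0 : ℝ) (max b 0)) (S.continuous_op_apply x).continuousOn
    exact ⟨c, fun t => hc t t.2⟩
  have h : ∀ t ≤ b, ‖S.op t‖ ≤ M := fun t ht => by
    rw [← S.op_max]
    exact hM ⟨max t 0, le_max_right _ _, max_le_max ht le_rfl⟩
  exact ⟨M, (norm_nonneg _).trans (h b le_rfl), h⟩

/-- Local boundedness of the norms upgrades strong continuity to joint continuity, which is needed
wherever time and vector move together: in the commutation argument and in the convolution
integrands. -/
theorem continuous_op [CompleteSpace X] : Continuous fun p : ℝ × X => S.op p.1 p.2 := by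
  rw [continuous_iff_continuousAt]
  rintro ⟨t₀, x₀⟩
  obtain ⟨M, hM0, hM⟩ := S.exists_norm_op_le (t₀ + 1)
  refine tendsto_iff_norm_sub_tendsto_zero.2 ?_
  have h1 : Tendsto (fun p : ℝ × X => M * ‖p.2 - x₀‖ + ‖S.op p.1 x₀ - S.op t₀ x₀‖)
      (𝓝 (t₀, x₀)) (𝓝 0) := by
    have hc : Continuous fun p : ℝ × X => M * ‖p.2 - x₀‖ + ‖S.op p.1 x₀ - S.op t₀ x₀‖ :=
      (continuous_const.mul (continuous_snd.sub continuous_const).norm).add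
        (((S.continuous_op_apply x₀).comp continuous_fst).sub continuous_const).norm
    simpa using hc.tendsto (t₀, x₀)
  refine squeeze_zero' (Eventually.of_forall fun _ => norm_nonneg _) ?_ h1
  have : ∀ᶠ p : ℝ × X in 𝓝 (t₀, x₀), p.1 < t₀ + 1 :=
    continuous_fst.continuousAt.eventually_lt continuousAt_const (by simp)
  filter_upwards [this] with p hp
  calc ‖S.op p.1 p.2 - S.op t₀ x₀‖
      = ‖S.op p.1 (p.2 - x₀) + (S.op p.1 x₀ - S.op t₀ x₀)‖ := by rw [map_sub]; congr 1; abel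
    _ ≤ ‖S.op p.1‖ * ‖p.2 - x₀‖ + ‖S.op p.1 x₀ - S.op t₀ x₀‖ :=
        (norm_add_le _ _).trans (by gcongr; exact ContinuousLinearMap.le_opNorm _ _)
    _ ≤ _ := by gcongr; exact hM _ hp.le

theorem aestronglyMeasurable_op [CompleteSpace X] {α : Type*} [MeasurableSpace α] {μ : Measure α}
    {φ : α → ℝ} {g : α → X} (hφ : AEStronglyMeasurable φ μ) (hg : AEStronglyMeasurable g μ) :
    AEStronglyMeasurable (fun a => S.op (φ a) (g a)) μ :=
  S.continuous_op.comp_aestronglyMeasurable (hφ.prodMk hg)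

variable {S}

/-- With a real parameter and real scalars, the defining limit becomes a right derivative,
accessible to calculus on `ℝ`. -/
theorem hasGenValue_iff {x y : X} :
    S.HasGenValue x y ↔ Tendsto (fun h : ℝ => h⁻¹ • (S.op h x - x)) (𝓝[>] 0) (𝓝 y) := by
  have e : ∀ (h : ℝ) (v : X), ((h : ℂ))⁻¹ • v = h⁻¹ • v := fun h v => by
    rw [← Complex.ofReal_inv, Complex.coe_smul]
  constructor
  · intro H
    have ht : Tendsto Real.toNNReal (𝓝[>] 0) (𝓝[>] 0) := by
      refine tendsto_nhdsWithin_iff.2 ⟨?_, ?_⟩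
      · simpa using (continuous_real_toNNReal.tendsto 0).mono_left nhdsWithin_le_nhds
      · filter_upwards [self_mem_nhdsWithin] with h hh
        exact Real.toNNReal_pos.2 hh
    refine (Tendsto.comp H ht).congr' ?_
    filter_upwards [self_mem_nhdsWithin] with h hh
    simp only [Function.comp, Real.coe_toNNReal h (le_of_lt hh), e, op]
  · intro H
    have ht : Tendsto ((↑) : ℝ≥0 → ℝ) (𝓝[>] 0) (𝓝[>] 0) := by
      refine tendsto_nhdsWithin_iff.2 ⟨?_, ?_⟩
      · simpa using (NNReal.continuous_coe.tendsto 0).mono_left nhdsWithin_le_nhds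
      · filter_upwards [self_mem_nhdsWithin] with h hh
        exact NNReal.coe_pos.2 hh
    refine (Tendsto.comp H ht).congr fun h => ?_
    simp only [Function.comp, e, op, Real.toNNReal_coe]

theorem generator_apply_eq {x y : X} (h : S.HasGenValue x y) (hx : x ∈ S.generator.domain) :
    S.generator ⟨x, hx⟩ = y :=
  HasGenValue.unique (Exists.choose_spec hx) h

theorem hasGenValue_generator (x : S.generator.domain) : S.HasGenValue x (S.generator x) :=
  Exists.choose_spec x.2

theorem HasGenValue.mem_domain {x y : X} (h : S.HasGenValue x y) : x ∈ S.generator.domain :=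
  ⟨y, h⟩

theorem HasGenValue.map {C : X →L[ℂ] X} {x y : X} (h : S.HasGenValue x y)
    (hC : ∀ t ≥ 0, S.op t (C x) = C (S.op t x)) : S.HasGenValue (C x) (C y) := by
  rw [hasGenValue_iff] at h ⊢
  refine ((C.continuous.tendsto y).comp h).congr' ?_
  filter_upwards [self_mem_nhdsWithin] with t ht
  simp [hC t (le_of_lt ht), ← Complex.coe_smul]

theorem HasGenValue.op {x y : X} (h : S.HasGenValue x y) {t : ℝ} (ht : 0 ≤ t) :
    S.HasGenValue (S.op t x) (S.op t y) :=
  h.map fun _ hs => S.op_comm hs ht x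

theorem HasGenValue.of_commutesWith {C : X →L[ℂ] X} (hC : CommutesWith C S.generator) {x y : X}
    (h : S.HasGenValue x y) : S.HasGenValue (C x) (C y) := by
  obtain ⟨hm, e⟩ := hC ⟨x, h.mem_domain⟩
  have := hasGenValue_generator ⟨C x, hm⟩
  rwa [e, generator_apply_eq h] at this

/-- On the domain of the generator, an operator that commutes with the generator commutes with the
semigroup. -/
theorem HasGenValue.comm_op [CompleteSpace X] {C : X →L[ℂ] X}
    (hC : CommutesWith C S.generator) {x y : X} (h : S.HasGenValue x y) {t : ℝ} (ht : 0 ≤ t) :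
    S.op t (C x) = C (S.op t x) := by
  -- The function `S(t-s) C S(s) x` interpolates between `S(t) C x` and `C S(t) x`; its derivative
  -- is `S(t-s)(CB - BC)S(s)x = 0`. A right derivative suffices, and it is all that the generator
  -- provides directly.
  have key := constant_of_has_deriv_right_zero (f := fun s => S.op (t - s) (C (S.op s x)))
    (a := 0) (b := t) ?_ ?_ t ⟨ht, le_rfl⟩
  · simpa [op_zero_apply] using key.symm
  · exact (S.continuous_op.comp ((continuous_const.sub continuous_id).prodMk
      (C.continuous.comp (S.continuous_op_apply x)))).continuousOn
  · intro s hs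
    rw [hasDerivWithinAt_iff_tendsto_slope, Ici_sdiff_left]
    have h1 := (hasGenValue_iff.1 (h.op hs.1))
    have h2 := hasGenValue_iff.1 ((h.op hs.1).of_commutesWith hC)
    have hsh : Tendsto (fun r : ℝ => r - s) (𝓝[>] s) (𝓝[>] 0) := by
      refine tendsto_nhdsWithin_iff.2 ⟨?_, ?_⟩
      · have hc : Continuous fun r : ℝ => r - s := by fun_prop
        simpa using (hc.tendsto s).mono_left nhdsWithin_le_nhds
      · filter_upwards [self_mem_nhdsWithin] with r hr
        exact sub_pos.2 (mem_Ioi.1 hr)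
    -- Both quotients tend to `C S(s) y`, so their difference tends to zero. The factor `S(t-r)`,
    -- pulled out in front below, is harmless by joint continuity.
    have h12 := (((C.continuous.tendsto _).comp h1).sub h2).comp hsh
    have hop : Tendsto (fun r : ℝ => t - r) (𝓝[>] s) (𝓝 (t - s)) :=
      ((continuous_const.sub continuous_id).tendsto (s : ℝ)).mono_left nhdsWithin_le_nhds
    have h3 := (S.continuous_op.tendsto _).comp (hop.prodMk_nhds h12)
    rw [sub_self, map_zero] at h3
    refine h3.congr' ?_
    have hlt : ∀ᶠ r in 𝓝[>] s, r < t := nhdsWithin_le_nhds (eventually_lt_nhds hs.2)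
    filter_upwards [self_mem_nhdsWithin, hlt] with r hr hrt
    have hr' : 0 ≤ r - s := (sub_pos.2 (mem_Ioi.1 hr)).le
    have e1 : S.op r x = S.op (r - s) (S.op s x) := by
      rw [← S.op_add hr' hs.1, sub_add_cancel]
    have e2 : S.op (t - s) (C (S.op s x)) = S.op (t - r) (S.op (r - s) (C (S.op s x))) := by
      rw [← S.op_add (sub_pos.2 hrt).le hr', sub_add_sub_cancel]
    simp only [Function.comp, slope, vsub_eq_sub, e1, e2]
    simp only [← Complex.coe_smul, map_sub, map_smul, ← smul_sub]
    congr 1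
    abel

end Basic

/-! ### The resolvent as the Laplace transform of the semigroup. -/

section Laplace

variable {X : Type*} [NormedAddCommGroup X] [NormedSpace ℂ X]
variable {S : C0Semigroup X} {M ω : ℝ} {z : ℂ}

theorem norm_exp_smul_op_le (hM : ∀ t ≥ 0, ‖S.op t‖ ≤ M * Real.exp (ω * t)) (z : ℂ) (x : X)
    {t : ℝ} (ht : 0 ≤ t) :
    ‖Complex.exp (-z * t) • S.op t x‖ ≤ Real.exp ((ω - z.re) * t) * (M * ‖x‖) := by
  rw [norm_smul, Complex.norm_exp]
  have e : (-z * (t : ℂ)).re = -z.re * t := by simp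
  rw [e]
  calc _ ≤ Real.exp (-z.re * t) * (M * Real.exp (ω * t) * ‖x‖) := by
        gcongr
        exact (S.op t).le_of_opNorm_le (hM t ht) x
    _ = Real.exp (-z.re * t) * Real.exp (ω * t) * (M * ‖x‖) := by ring
    _ = _ := by rw [← Real.exp_add]; ring_nf

theorem continuous_exp_smul_op (S : C0Semigroup X) (z : ℂ) (x : X) :
    Continuous fun t : ℝ => Complex.exp (-z * t) • S.op t x :=
  (by fun_prop : Continuous fun t : ℝ => Complex.exp (-z * t)).smul (S.continuous_op_apply x)

theorem integrableOn_exp_smul_op (hM : ∀ t ≥ 0, ‖S.op t‖ ≤ M * Real.exp (ω * t))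
    (hz : ω < z.re) (x : X) :
    IntegrableOn (fun t : ℝ => Complex.exp (-z * t) • S.op t x) (Ioi 0) := by
  refine Integrable.mono' ((integrableOn_exp_mul_Ioi (sub_neg.2 hz) 0).mul_const (M * ‖x‖))
    (S.continuous_exp_smul_op z x).aestronglyMeasurable ?_
  filter_upwards [ae_restrict_mem measurableSet_Ioi] with t ht
  exact norm_exp_smul_op_le hM z x (le_of_lt ht)

/-- The Laplace transform of a semigroup of type `ω`, at a point `z` with `ω < re z`. -/
def laplace (S : C0Semigroup X) (hM : ∀ t ≥ 0, ‖S.op t‖ ≤ M * Real.exp (ω * t))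
    (hz : ω < z.re) : X →L[ℂ] X :=
  LinearMap.mkContinuous
    { toFun := fun x => ∫ t : ℝ in Ioi 0, Complex.exp (-z * t) • S.op t x
      map_add' := fun x y => by
        rw [← integral_add (integrableOn_exp_smul_op hM hz x) (integrableOn_exp_smul_op hM hz y)]
        simp only [map_add, smul_add]
      map_smul' := fun c x => by
        rw [RingHom.id_apply, ← integral_smul]
        simp only [map_smul, smul_comm c] }
    (M * (z.re - ω)⁻¹) fun x => by
      refine (norm_integral_le_of_norm_le
        ((integrableOn_exp_mul_Ioi (sub_neg.2 hz) 0).mul_const (M * ‖x‖)) ?_).trans_eq ?_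
      · filter_upwards [ae_restrict_mem measurableSet_Ioi] with t ht
        exact norm_exp_smul_op_le hM z x (le_of_lt ht)
      · rw [integral_mul_const, integral_exp_mul_Ioi (sub_neg.2 hz), mul_zero, Real.exp_zero,
          ← neg_sub z.re ω, neg_div_neg_eq, one_div]
        ring

variable (hM : ∀ t ≥ 0, ‖S.op t‖ ≤ M * Real.exp (ω * t)) (hz : ω < z.re)

theorem laplace_apply (x : X) :
    S.laplace hM hz x = ∫ t : ℝ in Ioi 0, Complex.exp (-z * t) • S.op t x := rfl

theorem norm_laplace_le (hM0 : 0 ≤ M) : ‖S.laplace hM hz‖ ≤ M * (z.re - ω)⁻¹ :=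
  LinearMap.mkContinuous_norm_le _ (mul_nonneg hM0 (inv_nonneg.2 (sub_pos.2 hz).le)) _

variable [CompleteSpace X]

theorem op_laplace_comm {s : ℝ} (hs : 0 ≤ s) (x : X) :
    S.op s (S.laplace hM hz x) = S.laplace hM hz (S.op s x) := by
  rw [laplace_apply, laplace_apply,
    ← ContinuousLinearMap.integral_comp_comm _ (integrableOn_exp_smul_op hM hz x)]
  refine setIntegral_congr_fun measurableSet_Ioi fun t ht => ?_
  simp only [map_smul]
  rw [S.op_comm hs (le_of_lt ht)]

/-- Substituting `t + h` for the time variable moves `S(h)` into the integral; the dependence on `h`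
is then explicit and differentiable at zero. -/
theorem op_laplace_eq {h : ℝ} (hh : 0 ≤ h) (x : X) :
    S.op h (S.laplace hM hz x) = Complex.exp (z * h) •
      (S.laplace hM hz x - ∫ t in (0 : ℝ)..h, Complex.exp (-z * t) • S.op t x) := by
  have hint := integrableOn_exp_smul_op hM hz x
  rw [← intervalIntegral.integral_Ioi_sub_Ioi hint hh, laplace_apply, sub_sub_cancel,
    ← ContinuousLinearMap.integral_comp_comm _ hint, ← integral_smul]
  have e := (measurePreserving_add_right (volume : Measure ℝ) h).setIntegral_preimage_emb
    (measurableEmbedding_addRight h)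
    (fun t : ℝ => Complex.exp (z * h) • Complex.exp (-z * t) • S.op t x) (Ioi h)
  rw [← e]
  have hpre : (fun t : ℝ => t + h) ⁻¹' Ioi h = Ioi 0 := by ext; simp
  rw [hpre]
  refine setIntegral_congr_fun measurableSet_Ioi fun t ht => ?_
  simp only [map_smul]
  rw [add_comm t h, S.op_add hh (le_of_lt ht), smul_smul, ← Complex.exp_add]
  congr 2
  push_cast
  ring

/-- The product rule at `h = 0` applied to `op_laplace_eq`: the exponential contributes `z` times
the transform, the integral contributes `-x`. -/
theorem hasGenValue_laplace (x : X) :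
    S.HasGenValue (S.laplace hM hz x) (z • S.laplace hM hz x - x) := by
  rw [hasGenValue_iff]
  set y := S.laplace hM hz x with hy
  have hc := S.continuous_exp_smul_op z x
  have d1 : HasDerivAt (fun h : ℝ => Complex.exp (z * h)) z 0 := by
    have := ((Complex.ofRealCLM.hasDerivAt (x := 0)).const_mul z).cexp
    simpa using this
  have d2 : HasDerivAt (fun h : ℝ => y - ∫ t in (0 : ℝ)..h, Complex.exp (-z * t) • S.op t x)
      (-x) 0 := by
    have := (hc.integral_hasStrictDerivAt 0 0).hasDerivAt.const_sub y
    simpa [op_zero_apply] using this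
  have d := d1.smul d2
  rw [hasDerivAt_iff_tendsto_slope_zero] at d
  simp only [Pi.smul_apply', zero_add, Complex.ofReal_zero, mul_zero, Complex.exp_zero, one_smul,
    intervalIntegral.integral_same, sub_zero] at d
  have d' := d.mono_left (nhdsWithin_mono 0 (fun h (hh : 0 < h) => ne_of_gt hh))
  rw [neg_add_eq_sub] at d'
  refine d'.congr' ?_
  filter_upwards [self_mem_nhdsWithin] with h hh
  rw [hy, op_laplace_eq hM hz (le_of_lt hh), ← hy]

/-- The right inverse property is `hasGenValue_laplace`. The left one follows because the transform
commutes with the semigroup, hence with the generator. -/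
theorem isResolventAt_laplace : IsResolventAt S.generator z (S.laplace hM hz) := by
  refine ⟨fun x => ⟨(hasGenValue_laplace hM hz x).mem_domain, ?_⟩, fun x => ?_⟩
  · rw [generator_apply_eq (hasGenValue_laplace hM hz x), sub_sub_cancel]
  · have h1 := hasGenValue_laplace hM hz (x : X)
    have h2 := (hasGenValue_generator x).map (C := S.laplace hM hz)
      fun t ht => op_laplace_comm hM hz ht _
    rw [map_sub, map_smul, h2.unique h1, sub_sub_cancel]

end Laplace

end C0Semigroup

/-! ### Uniqueness of resolvents and commuting operators. -/

section Resolvent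

variable {X : Type*} [NormedAddCommGroup X] [NormedSpace ℂ X] {B : X →ₗ.[ℂ] X} {z : ℂ}

theorem IsResolventAt.unique {R R' : X →L[ℂ] X} (h : IsResolventAt B z R)
    (h' : IsResolventAt B z R') : R = R' := by
  ext x
  obtain ⟨hx, e⟩ := h.1 x
  have := h'.2 ⟨R x, hx⟩
  rw [e] at this
  exact this.symm

theorem IsResolventAt.resolventOp_eq {R : X →L[ℂ] X} (h : IsResolventAt B z R) :
    resolventOp B z = R := by
  have hex : ∃ R, IsResolventAt B z R := ⟨R, h⟩
  rw [resolventOp, dif_pos hex]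
  exact hex.choose_spec.unique h

theorem IsResolventAt.injective {R : X →L[ℂ] X} (h : IsResolventAt B z R) :
    Function.Injective R := by
  refine (injective_iff_map_eq_zero _).2 fun x hx => ?_
  obtain ⟨hm, e⟩ := h.1 x
  have : (⟨R x, hm⟩ : B.domain) = 0 := Subtype.ext hx
  rw [this, LinearPMap.map_zero, hx, smul_zero, sub_zero] at e
  exact e.symm

theorem IsResolventAt.comm {R C : X →L[ℂ] X} (h : IsResolventAt B z R) (hC : CommutesWith C B)
    (x : X) : R (C x) = C (R x) := by
  obtain ⟨hm, e⟩ := h.1 x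
  obtain ⟨hm', e'⟩ := hC ⟨R x, hm⟩
  have := h.2 ⟨C (R x), hm'⟩
  rw [e'] at this
  conv_lhs => rw [← e]
  simpa using this

/-- An operator that commutes with the generator commutes with the semigroup. -/
theorem CommutesWith.op_comm [CompleteSpace X] {S : C0Semigroup X} {C : X →L[ℂ] X}
    (hC : CommutesWith C S.generator) {M ω : ℝ}
    (hM : ∀ t ≥ 0, ‖S.op t‖ ≤ M * Real.exp (ω * t)) {t : ℝ} (ht : 0 ≤ t) (x : X) :
    S.op t (C x) = C (S.op t x) := by
  have hz : ω < ((ω + 1 : ℝ) : ℂ).re := by simp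
  have hR := C0Semigroup.isResolventAt_laplace hM hz
  -- The resolvent commutes with `C` and with the semigroup and maps into the domain, where
  -- commutation is known; being injective, it can be cancelled.
  refine hR.injective ?_
  have h1 := (C0Semigroup.hasGenValue_laplace hM hz x).comm_op hC ht
  rw [hR.comm hC, ← C0Semigroup.op_laplace_comm hM hz ht, ← C0Semigroup.op_laplace_comm hM hz ht,
    hR.comm hC, h1]

end Resolvent

/-! ### Convolution with an exponentially stable semigroup -/

section Convolution

variable {X : Type*} [NormedAddCommGroup X] [NormedSpace ℂ X]

/-- The causal convolution `t ↦ ∫_0^∞ S(r) g(t - r) dr`. -/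
def conv (S : C0Semigroup X) (g : ℝ → X) (t : ℝ) : X := ∫ r in Ioi (0 : ℝ), S.op r (g (t - r))

variable {S : C0Semigroup X}

theorem conv_congr_ae {g g' : ℝ → X} (h : g =ᵐ[volume] g') (t : ℝ) :
    conv S g t = conv S g' t := by
  refine integral_congr_ae (ae_restrict_of_ae ?_)
  filter_upwards [(Measure.measurePreserving_sub_left volume t).quasiMeasurePreserving.ae_eq_comp h]
    with r hr
  rw [show g (t - r) = g' (t - r) from hr]

variable {M ω : ℝ} [CompleteSpace X]

theorem aestronglyMeasurable_conv_integrand {g : ℝ → X} (hg : AEStronglyMeasurable g volume)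
    (t : ℝ) : AEStronglyMeasurable (fun r => S.op r (g (t - r))) volume :=
  S.aestronglyMeasurable_op aestronglyMeasurable_id
    (hg.comp_measurePreserving (Measure.measurePreserving_sub_left volume t))

-- Cauchy–Schwarz against `M e^{ω r}`, which is square integrable on the half line as `ω < 0`. The
-- bound is uniform in `t` because reflection and translation preserve the norm of `g`.
omit [CompleteSpace X] in
theorem exists_lintegral_conv_le (hM : ∀ t ≥ 0, ‖S.op t‖ ≤ M * Real.exp (ω * t)) (hω : ω < 0) :
    ∃ κ : ℝ≥0, ∀ g : ℝ → X, AEStronglyMeasurable g volume → ∀ t : ℝ,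
      ∫⁻ r in Ioi (0 : ℝ), ‖S.op r (g (t - r))‖ₑ ≤ κ * eLpNorm g 2 volume := by
  set e : ℝ → ℝ := fun r => M * Real.exp (ω * r) with he
  have hec : Continuous e := by fun_prop
  have hem : MemLp e 2 (volume.restrict (Ioi (0 : ℝ))) := by
    refine (memLp_two_iff_integrable_sq hec.aestronglyMeasurable).2 ?_
    have : (fun r => e r ^ 2) = fun r => M ^ 2 * Real.exp ((2 * ω) * r) := by
      ext r
      rw [he, mul_pow, ← Real.exp_nat_mul]
      congr 2
      push_cast
      ring
    rw [this]
    exact (integrableOn_exp_mul_Ioi (by linarith) 0).const_mul _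
  refine ⟨(eLpNorm e 2 (volume.restrict (Ioi (0 : ℝ)))).toNNReal, fun g hg t => ?_⟩
  rw [ENNReal.coe_toNNReal hem.2.ne]
  have hmp := Measure.measurePreserving_sub_left (volume : Measure ℝ) t
  calc ∫⁻ r in Ioi (0 : ℝ), ‖S.op r (g (t - r))‖ₑ
      ≤ ∫⁻ r in Ioi (0 : ℝ), ‖(e • fun r => g (t - r)) r‖ₑ := by
        refine setLIntegral_mono' measurableSet_Ioi fun r hr => ?_
        have h := (S.op r).le_of_opNorm_le (hM r (le_of_lt hr)) (g (t - r))
        rw [Pi.smul_apply', enorm_smul, ← ofReal_norm, ← ofReal_norm, ← ofReal_norm,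
          ← ENNReal.ofReal_mul (norm_nonneg _)]
        refine ENNReal.ofReal_le_ofReal (h.trans ?_)
        gcongr
        exact le_abs_self _
    _ = eLpNorm (e • fun r => g (t - r)) 1 (volume.restrict (Ioi (0 : ℝ))) :=
        eLpNorm_one_eq_lintegral_enorm.symm
    _ ≤ eLpNorm e 2 (volume.restrict (Ioi (0 : ℝ))) *
          eLpNorm (fun r => g (t - r)) 2 (volume.restrict (Ioi (0 : ℝ))) :=
        eLpNorm_smul_le_mul_eLpNorm (hg.comp_measurePreserving hmp).restrict
          hec.aestronglyMeasurable
    _ ≤ _ := by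
        gcongr
        exact (eLpNorm_mono_measure _ Measure.restrict_le_self).trans_eq
          (eLpNorm_comp_measurePreserving hg hmp)

section Stable

variable (hM : ∀ t ≥ 0, ‖S.op t‖ ≤ M * Real.exp (ω * t)) (hω : ω < 0)
include hM hω

theorem integrable_conv {g : ℝ → X} (hg : MemLp g 2 volume) (t : ℝ) :
    IntegrableOn (fun r => S.op r (g (t - r))) (Ioi 0) := by
  obtain ⟨κ, hκ⟩ := exists_lintegral_conv_le hM hω
  exact ⟨(aestronglyMeasurable_conv_integrand hg.1 t).restrict,
    (hκ g hg.1 t).trans_lt (ENNReal.mul_lt_top ENNReal.coe_lt_top hg.2)⟩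

theorem conv_add {f g : ℝ → X} (hf : MemLp f 2 volume) (hg : MemLp g 2 volume) (t : ℝ) :
    conv S (f + g) t = conv S f t + conv S g t := by
  simp only [conv]
  rw [← integral_add (integrable_conv hM hω hf t) (integrable_conv hM hω hg t)]
  simp

omit hM hω [CompleteSpace X] in
theorem conv_smul (c : ℂ) (g : ℝ → X) (t : ℝ) : conv S (c • g) t = c • conv S g t := by
  simp only [conv]
  rw [← integral_smul]
  simp

omit [CompleteSpace X] in
theorem exists_norm_conv_le :
    ∃ κ : ℝ, 0 ≤ κ ∧ ∀ (g : Lp X 2 (volume : Measure ℝ)) (t : ℝ), ‖conv S g t‖ ≤ κ * ‖g‖ := by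
  obtain ⟨κ, hκ⟩ := exists_lintegral_conv_le hM hω
  refine ⟨κ, κ.2, fun g t => ?_⟩
  have h := (enorm_integral_le_lintegral_enorm _).trans (hκ g (Lp.aestronglyMeasurable g) t)
  have := ENNReal.toReal_mono
    (ENNReal.mul_ne_top ENNReal.coe_ne_top (Lp.eLpNorm_ne_top g)) h
  rwa [ENNReal.toReal_mul, toReal_enorm] at this

/-- Evaluation of the convolution at time `0`, as a bounded operator on `L²`. -/
theorem exists_convZero : ∃ k : Lp X 2 (volume : Measure ℝ) →L[ℂ] X, ∀ g, k g = conv S g 0 := by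
  obtain ⟨κ, -, hκ⟩ := exists_norm_conv_le hM hω
  refine ⟨LinearMap.mkContinuous
    { toFun := fun g => conv S g 0
      map_add' := fun f g => ?_
      map_smul' := fun c g => ?_ } κ fun g => hκ g 0, fun g => rfl⟩
  · rw [conv_congr_ae (Lp.coeFn_add f g), conv_add hM hω (Lp.memLp f) (Lp.memLp g)]
  · rw [conv_congr_ae (Lp.coeFn_smul c g), conv_smul, RingHom.id_apply]

end Stable

/-- Translation `(τ_a g)(t) = g(t + a)` on `L²(ℝ, X)`. -/
def transl (X : Type*) [NormedAddCommGroup X] [NormedSpace ℂ X] (a : ℝ) :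
    Lp X 2 (volume : Measure ℝ) →L[ℂ] Lp X 2 (volume : Measure ℝ) :=
  (Lp.compMeasurePreservingₗᵢ ℂ (fun t => t + a)
    (measurePreserving_add_right volume a)).toContinuousLinearMap

omit [CompleteSpace X] in
theorem coeFn_transl (a : ℝ) (g : Lp X 2 (volume : Measure ℝ)) :
    transl X a g =ᵐ[volume] fun t => g (t + a) :=
  Lp.coeFn_compMeasurePreserving g (measurePreserving_add_right volume a)

omit [CompleteSpace X] in
theorem norm_transl (a : ℝ) (g : Lp X 2 (volume : Measure ℝ)) : ‖transl X a g‖ = ‖g‖ :=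
  (Lp.compMeasurePreservingₗᵢ ℂ (fun t => t + a)
    (measurePreserving_add_right volume a)).norm_map g

omit [CompleteSpace X] in
theorem continuous_transl (g : Lp X 2 (volume : Measure ℝ)) :
    Continuous fun a => transl X a g := by
  have hc : Continuous fun a : ℝ => (⟨fun t => t + a, by fun_prop⟩ : C(ℝ, ℝ)) :=
    ContinuousMap.continuous_of_continuous_uncurry _ (by
      simp only [Function.uncurry_def, ContinuousMap.coe_mk]; fun_prop)
  exact (continuous_const (y := g)).compMeasurePreservingLp hc
    (fun a => measurePreserving_add_right volume a) (by simp)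

omit [CompleteSpace X] in
theorem ae_comp_add {p : ℝ → Prop} (h : ∀ᵐ t, p t) (a : ℝ) : ∀ᵐ t, p (t + a) :=
  (measurePreserving_add_right volume a).quasiMeasurePreserving.ae h

omit [CompleteSpace X] in
theorem ae_comp_sub_left {p : ℝ → Prop} (h : ∀ᵐ t, p t) (a : ℝ) : ∀ᵐ t, p (a - t) :=
  (Measure.measurePreserving_sub_left volume a).quasiMeasurePreserving.ae h

omit [CompleteSpace X] in
theorem conv_transl (g : Lp X 2 (volume : Measure ℝ)) (a t : ℝ) :
    conv S (transl X a g) t = conv S g (t + a) := by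
  rw [conv_congr_ae (coeFn_transl a g)]
  simp only [conv, sub_add_eq_add_sub]

/-- The value at `t` is a fixed bounded functional applied to the translate of `g`, and translation
is strongly continuous on `L²`. Thus point values of the convolution are meaningful although `g` is
only a class. -/
theorem continuous_conv (hM : ∀ t ≥ 0, ‖S.op t‖ ≤ M * Real.exp (ω * t)) (hω : ω < 0)
    (g : Lp X 2 (volume : Measure ℝ)) : Continuous (conv S g) := by
  obtain ⟨k, hk⟩ := exists_convZero hM hω
  refine (k.continuous.comp (continuous_transl g)).congr fun t => ?_
  rw [Function.comp, hk, conv_transl, zero_add]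

end Convolution

/-! ### The norm of the convolution operator -/

section Plancherel

open FourierTransform SchwartzMap

variable {X : Type*} [NormedAddCommGroup X] [InnerProductSpace ℂ X] [CompleteSpace X]

/-- On `L¹ ∩ L²` the Fourier transform of `L²` agrees with the Fourier integral. -/
theorem coeFn_fourier_toLp {h : ℝ → X} (h1 : Integrable h) (h2 : MemLp h 2 volume) :
    (𝓕 (h2.toLp h) : Lp X 2 (volume : Measure ℝ)) =ᵐ[volume] 𝓕 h := by
  have hcont : Continuous (𝓕 h) :=
    VectorFourier.fourierIntegral_continuous Real.continuous_fourierChar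
      (innerSL ℝ).continuous₂ h1
  have hl1 : LocallyIntegrable (𝓕 (h2.toLp h) : Lp X 2 (volume : Measure ℝ)) volume :=
    (Lp.memLp _).locallyIntegrable (by norm_num)
  have hl2 : LocallyIntegrable (𝓕 h) volume := hcont.locallyIntegrable
  have key : ∀ᵐ t, ((𝓕 (h2.toLp h) : Lp X 2 (volume : Measure ℝ)) : ℝ → X) t - 𝓕 h t = 0 := by
    refine ae_eq_zero_of_integral_contDiff_smul_eq_zero (hl1.sub hl2) fun φ hφ hc => ?_
    have hφ' : ContDiff ℝ (↑(⊤ : ℕ∞)) fun t => (φ t : ℂ) := Complex.ofRealCLM.contDiff.comp hφ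
    have hc' : HasCompactSupport fun t => (φ t : ℂ) := hc.comp_left Complex.ofReal_zero
    set ψ : 𝓢(ℝ, ℂ) := hc'.toSchwartzMap hφ' with hψ
    have hψe : ∀ t, ψ t = (φ t : ℂ) := fun t => rfl
    have i1 : Integrable (fun t => φ t • (𝓕 (h2.toLp h) : Lp X 2 (volume : Measure ℝ)) t) :=
      hl1.integrable_smul_left_of_hasCompactSupport hφ.continuous hc
    have i2 : Integrable (fun t => φ t • 𝓕 h t) :=
      hl2.integrable_smul_left_of_hasCompactSupport hφ.continuous hc
    simp only [smul_sub]
    rw [integral_sub i1 i2, sub_eq_zero]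
    have e := congrArg (fun T : 𝓢'(ℝ, X) => T ψ) (Lp.fourier_toTemperedDistribution_eq (h2.toLp h))
    simp only [TemperedDistribution.fourier_apply, Lp.toTemperedDistribution_apply, hψe,
      Complex.coe_smul] at e
    rw [← e]
    -- The `L²` transform is determined by duality with Schwartz functions; for integrable `h` the
    -- same duality is the multiplication formula.
    have e2 := VectorFourier.integral_fourierIntegral_smul_eq_flip (μ := volume) (ν := volume)
      (L := innerₗ ℝ) Real.continuous_fourierChar (innerSL ℝ).continuous₂ ψ.integrable h1
    rw [flip_innerₗ] at e2
    calc ∫ t, (𝓕 ψ) t • (h2.toLp h) t = ∫ t, (𝓕 (ψ : ℝ → ℂ)) t • h t := by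
          refine integral_congr_ae ?_
          filter_upwards [h2.coeFn_toLp] with t ht
          rw [ht, SchwartzMap.fourier_coe]
      _ = ∫ t, ψ t • 𝓕 h t := e2
      _ = _ := by simp only [hψe, Complex.coe_smul]
  filter_upwards [key] with t ht
  exact sub_eq_zero.1 ht

variable {S : C0Semigroup X} {M ω : ℝ}

section Stable

variable (hM : ∀ t ≥ 0, ‖S.op t‖ ≤ M * Real.exp (ω * t)) (hω : ω < 0)
include hM hω

theorem integrable_prod_conv {g : ℝ → X} (hgc : Continuous g) (hg : Integrable g) :
    Integrable (fun p : ℝ × ℝ => S.op p.1 (g (p.2 - p.1)))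
      ((volume.restrict (Ioi (0 : ℝ))).prod volume) := by
  have hc : Continuous fun p : ℝ × ℝ => S.op p.1 (g (p.2 - p.1)) :=
    S.continuous_op.comp (continuous_fst.prodMk (hgc.comp (continuous_snd.sub continuous_fst)))
  have hi : ∀ r, Integrable fun t => S.op r (g (t - r)) := fun r =>
    (S.op r).integrable_comp (hg.comp_sub_right r)
  refine (integrable_prod_iff hc.aestronglyMeasurable).2 ⟨Eventually.of_forall hi, ?_⟩
  refine Integrable.mono' (g := fun r => M * Real.exp (ω * r) * ∫ t, ‖g t‖)
    (((integrableOn_exp_mul_Ioi hω 0).const_mul M).mul_const _)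
    hc.norm.stronglyMeasurable.integral_prod_right.aestronglyMeasurable ?_
  filter_upwards [ae_restrict_mem measurableSet_Ioi] with r hr
  rw [Real.norm_of_nonneg (integral_nonneg fun t => norm_nonneg _)]
  calc ∫ t, ‖S.op r (g (t - r))‖ ≤ ∫ t, M * Real.exp (ω * r) * ‖g (t - r)‖ :=
        integral_mono (hi r).norm ((hg.comp_sub_right r).norm.const_mul _) fun t =>
          (S.op r).le_of_opNorm_le (hM r (le_of_lt hr)) _
    _ = _ := by rw [integral_const_mul, integral_sub_right_eq_self fun t => ‖g t‖]

/-- Convolution theorem: by Fubini the transform is the Laplace transform of `S` at `2πiξ`, applied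
to `𝓕 g ξ`. The real part zero of this point exceeds `ω`, so the Laplace transform is the resolvent.
-/
theorem fourier_conv {g : ℝ → X} (hgc : Continuous g) (hg : Integrable g) (ξ : ℝ) :
    𝓕 (conv S g) ξ = resolventOp S.generator (Complex.I * (2 * Real.pi * ξ : ℝ)) (𝓕 g ξ) := by
  have hz : ω < (Complex.I * (2 * Real.pi * ξ : ℝ)).re := by simpa using hω
  rw [(C0Semigroup.isResolventAt_laplace hM hz).resolventOp_eq, C0Semigroup.laplace_apply,
    Real.fourier_real_eq_integral_exp_smul]
  have hp := (integrable_prod_conv hM hω hgc hg).swap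
  have hp' : Integrable (fun p : ℝ × ℝ =>
      Complex.exp (↑(-2 * Real.pi * p.1 * ξ) * Complex.I) • S.op p.2 (g (p.1 - p.2)))
      (volume.prod (volume.restrict (Ioi (0 : ℝ)))) := by
    refine hp.bdd_smul (C := 1) ?_ ?_
    · exact (by fun_prop : Continuous fun p : ℝ × ℝ =>
        Complex.exp (↑(-2 * Real.pi * p.1 * ξ) * Complex.I)).aestronglyMeasurable
    · exact Eventually.of_forall fun p => (Complex.norm_exp_ofReal_mul_I _).le
  have e1 : ∀ t : ℝ, Complex.exp (↑(-2 * Real.pi * t * ξ) * Complex.I) • conv S g t =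
      ∫ r in Ioi (0 : ℝ),
        Complex.exp (↑(-2 * Real.pi * t * ξ) * Complex.I) • S.op r (g (t - r)) := fun t => by
    rw [conv, integral_smul]
  simp only [e1]
  rw [integral_integral_swap (f := fun t r =>
    Complex.exp (↑(-2 * Real.pi * t * ξ) * Complex.I) • S.op r (g (t - r))) hp']
  refine integral_congr_ae (Eventually.of_forall fun r => ?_)
  simp only
  -- Translating `t` by `r` splits off the phase `e^{-2πiξr}`, the Laplace kernel.
  rw [← integral_sub_right_eq_self (μ := volume) (fun t => _) (-r)]
  have e2 : ∀ t : ℝ, Complex.exp (↑(-2 * Real.pi * (t - -r) * ξ) * Complex.I) •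
      S.op r (g (t - -r - r)) = Complex.exp (-(Complex.I * (2 * Real.pi * ξ : ℝ)) * r) •
        S.op r (Complex.exp (↑(-2 * Real.pi * t * ξ) * Complex.I) • g t) := fun t => by
    rw [sub_neg_eq_add, add_sub_cancel_right, map_smul, smul_smul, ← Complex.exp_add]
    congr 2
    push_cast
    ring
  simp only [e2]
  rw [integral_smul, ContinuousLinearMap.integral_comp_comm,
    ← Real.fourier_real_eq_integral_exp_smul]
  refine hg.bdd_smul (C := 1) ?_ ?_
  · exact (by fun_prop : Continuous fun t : ℝ =>
      Complex.exp (↑(-2 * Real.pi * t * ξ) * Complex.I)).aestronglyMeasurable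
  · exact Eventually.of_forall fun p => (Complex.norm_exp_ofReal_mul_I _).le

/-- Integrable by Fubini, bounded by Cauchy–Schwarz, hence square integrable. -/
theorem memLp_conv_schwartz (g : 𝓢(ℝ, X)) :
    Integrable (conv S g) ∧ MemLp (conv S g) 2 volume := by
  have hi : Integrable (conv S g) :=
    (integrable_prod_conv hM hω g.continuous g.integrable).integral_prod_right
  have e : ∀ t, conv S g t = conv S (g.toLp 2 volume) t := fun t =>
    (conv_congr_ae (g.coeFn_toLp 2 volume) t).symm
  obtain ⟨κ, -, hκ⟩ := exists_norm_conv_le hM hω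
  refine ⟨hi, (memLp_two_iff_integrable_sq_norm hi.1).2 ?_⟩
  refine Integrable.mono' (hi.norm.const_mul (κ * ‖g.toLp 2 volume‖)) (hi.1.norm.pow 2) ?_
  refine Eventually.of_forall fun t => ?_
  rw [norm_pow, norm_norm, sq]
  gcongr
  rw [e]
  exact hκ _ t

/-- Plancherel for `g` and for its convolution, with the pointwise resolvent bound in between. -/
theorem eLpNorm_conv_schwartz_le {m : ℝ≥0}
    (hm : ∀ s : ℝ, ‖resolventOp S.generator (Complex.I * (s : ℂ))‖ ≤ m) (g : 𝓢(ℝ, X)) :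
    eLpNorm (conv S g) 2 volume ≤ m * eLpNorm g 2 volume := by
  obtain ⟨h1, h2⟩ := memLp_conv_schwartz hM hω g
  have n : ∀ f : Lp X 2 (volume : Measure ℝ), eLpNorm f 2 volume = ‖f‖ₑ := fun f =>
    (Lp.enorm_def f).symm
  have a1 : eLpNorm (conv S g) 2 volume = eLpNorm (𝓕 (conv S g)) 2 volume := by
    rw [← eLpNorm_congr_ae (coeFn_fourier_toLp h1 h2), n, ← ofReal_norm, Lp.norm_fourier_eq,
      ofReal_norm, ← n, eLpNorm_congr_ae h2.coeFn_toLp]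
  have a2 : eLpNorm (𝓕 (g : ℝ → X)) 2 volume = eLpNorm g 2 volume := by
    rw [← eLpNorm_congr_ae (g.coeFn_toLp 2 volume), n, ← ofReal_norm,
      ← SchwartzMap.norm_fourier_toL2_eq, ofReal_norm, ← n,
      ← SchwartzMap.fourier_coe]
    exact (eLpNorm_congr_ae ((𝓕 g).coeFn_toLp 2 volume)).symm
  rw [a1, ← a2]
  refine eLpNorm_le_nnreal_smul_eLpNorm_of_ae_le_mul (Eventually.of_forall fun ξ => ?_) 2
  rw [fourier_conv hM hω g.continuous g.integrable]
  exact ContinuousLinearMap.le_of_opNorm_le _ (hm _) _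

/-- Schwartz functions are dense in `L²`. Convolutions of an approximating sequence converge at
every point, since evaluation is bounded on `L²`, so Fatou's lemma carries the bound to the limit.
-/
theorem eLpNorm_conv_le {m : ℝ≥0}
    (hm : ∀ s : ℝ, ‖resolventOp S.generator (Complex.I * (s : ℂ))‖ ≤ m)
    (g : Lp X 2 (volume : Measure ℝ)) :
    eLpNorm (conv S g) 2 volume ≤ m * ‖g‖ₑ := by
  have hd : g ∈ closure (range (SchwartzMap.toLpCLM ℝ X 2 (volume : Measure ℝ))) :=
    SchwartzMap.denseRange_toLpCLM (by norm_num) g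
  obtain ⟨f, hf, hlim⟩ := mem_closure_iff_seq_limit.1 hd
  choose φ hφ using hf
  have hfφ : ∀ n t, conv S (f n) t = conv S (φ n) t := fun n t => by
    rw [← hφ n]
    exact conv_congr_ae ((φ n).coeFn_toLp 2 volume) t
  have hfn : ∀ n, ‖f n‖ₑ = eLpNorm (φ n) 2 volume := fun n => by
    rw [← hφ n, Lp.enorm_def]
    exact eLpNorm_congr_ae ((φ n).coeFn_toLp 2 volume)
  obtain ⟨k, hk⟩ := exists_convZero hM hω
  have hkt : ∀ (u : Lp X 2 (volume : Measure ℝ)) t, conv S u t = k (transl X t u) := fun u t => by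
    rw [hk, conv_transl, zero_add]
  refine (Lp.eLpNorm_lim_le_liminf_eLpNorm (f := fun n => conv S (f n))
    (fun n => (continuous_conv hM hω (f n)).aestronglyMeasurable) _
    (Eventually.of_forall fun t => ?_)).trans ?_
  · simp only [hkt]
    exact ((k.continuous.comp (transl X t).continuous).tendsto g).comp hlim
  · have h1 : Tendsto (fun n => (m : ℝ≥0∞) * ‖f n‖ₑ) atTop (𝓝 (m * ‖g‖ₑ)) :=
      ENNReal.Tendsto.const_mul ((continuous_enorm.tendsto g).comp hlim)
        (Or.inr ENNReal.coe_ne_top)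
    rw [← h1.liminf_eq]
    refine liminf_le_liminf (Eventually.of_forall fun n => ?_)
    have := eLpNorm_conv_schwartz_le hM hω hm (φ n)
    rw [hfn]
    refine le_trans (le_of_eq ?_) this
    exact congrArg (fun u => eLpNorm u 2 volume) (funext (hfφ n))

/-- Convolution with the semigroup as a bounded operator on `L²(ℝ, X)`, with norm at most the
supremum of the resolvent on the imaginary axis. -/
theorem exists_convOp {m : ℝ≥0}
    (hm : ∀ s : ℝ, ‖resolventOp S.generator (Complex.I * (s : ℂ))‖ ≤ m) :
    ∃ K : Lp X 2 (volume : Measure ℝ) →L[ℂ] Lp X 2 (volume : Measure ℝ),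
      ‖K‖ ≤ m ∧ ∀ g, K g =ᵐ[volume] conv S g := by
  have hmem : ∀ g : Lp X 2 (volume : Measure ℝ), MemLp (conv S g) 2 volume := fun g =>
    ⟨(continuous_conv hM hω g).aestronglyMeasurable,
      (eLpNorm_conv_le hM hω hm g).trans_lt (ENNReal.mul_lt_top ENNReal.coe_lt_top (by simp))⟩
  refine ⟨LinearMap.mkContinuous
    { toFun := fun g => (hmem g).toLp
      map_add' := fun f g => ?_
      map_smul' := fun c g => ?_ } m fun g => ?_, ?_, fun g => (hmem g).coeFn_toLp⟩
  · rw [← MemLp.toLp_add]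
    refine MemLp.toLp_congr _ _ (Eventually.of_forall fun t => ?_)
    rw [conv_congr_ae (Lp.coeFn_add f g), conv_add hM hω (Lp.memLp f) (Lp.memLp g), Pi.add_apply]
  · rw [RingHom.id_apply, ← MemLp.toLp_const_smul]
    refine MemLp.toLp_congr _ _ (Eventually.of_forall fun t => ?_)
    rw [conv_congr_ae (Lp.coeFn_smul c g), conv_smul, Pi.smul_apply]
  · change ‖(hmem g).toLp‖ ≤ _
    rw [Lp.norm_toLp]
    refine (ENNReal.toReal_mono (by finiteness) (eLpNorm_conv_le hM hω hm g)).trans_eq ?_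
    rw [ENNReal.toReal_mul, toReal_enorm, ENNReal.coe_toReal]
  · exact LinearMap.mkContinuous_norm_le _ m.2 _

end Stable

end Plancherel

/-! ### Trajectories of the delay equation -/

section Trajectory

/-- The space `L²(ℝ, X)`. -/
abbrev LineL2 (X : Type*) [NormedAddCommGroup X] : Type _ := Lp X 2 (volume : Measure ℝ)

variable {X : Type*} [NormedAddCommGroup X] [NormedSpace ℂ X]

/-- Restriction of functions on the line to a set. -/
def restr (X : Type*) [NormedAddCommGroup X] [NormedSpace ℂ X] (s : Set ℝ) :
    LineL2 X →L[ℂ] Lp X 2 (volume.restrict s) :=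
  LpToLpRestrictCLM ℝ X ℂ volume 2 s

theorem coeFn_restr (s : Set ℝ) (g : LineL2 X) : restr X s g =ᵐ[volume.restrict s] g :=
  LpToLpRestrictCLM_coeFn ℂ s g

/-- The operator `C`, applied pointwise. -/
def pointwise (C : X →L[ℂ] X) : LineL2 X →L[ℂ] LineL2 X := C.compLpL 2 volume

theorem coeFn_pointwise (C : X →L[ℂ] X) (g : LineL2 X) :
    pointwise C g =ᵐ[volume] fun t => C (g t) :=
  C.coeFn_compLpL g

/-- The delayed term `t ↦ C g(t - 1)`. -/
def delayed (C : X →L[ℂ] X) : LineL2 X →L[ℂ] LineL2 X := (pointwise C).comp (transl X (-1))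

theorem coeFn_delayed (C : X →L[ℂ] X) (g : LineL2 X) :
    delayed C g =ᵐ[volume] fun t => C (g (t - 1)) := by
  filter_upwards [coeFn_pointwise C (transl X (-1) g), coeFn_transl (-1) g] with t h1 h2
  rw [delayed, ContinuousLinearMap.comp_apply, h1, h2, sub_eq_add_neg]

theorem pointwise_pow (C : X →L[ℂ] X) (n : ℕ) : pointwise C ^ n = pointwise (C ^ n) := by
  induction n with
  | zero =>
    ext1 g
    refine Lp.ext ?_
    filter_upwards [coeFn_pointwise (C ^ 0) g] with t h
    rw [h]
    simp
  | succ n ih =>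
    ext1 g
    refine Lp.ext ?_
    rw [pow_succ, ih]
    filter_upwards [coeFn_pointwise (C ^ (n + 1)) g, coeFn_pointwise (C ^ n) (pointwise C g),
      coeFn_pointwise C g] with t h1 h2 h3
    rw [h1, mul_apply_eq_comp, h2, h3, pow_succ, mul_apply_eq_comp]

theorem pointwise_transl_comm (C : X →L[ℂ] X) (a : ℝ) :
    Commute (pointwise C) (transl X a) := by
  ext1 g
  refine Lp.ext ?_
  simp only [mul_apply_eq_comp]
  filter_upwards [coeFn_pointwise C (transl X a g), coeFn_transl a g,
    coeFn_transl a (pointwise C g), ae_comp_add (coeFn_pointwise C g) a] with t h1 h2 h3 h4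
  rw [h1, h2, h3, h4]

variable {S : C0Semigroup X} {M ω : ℝ} [CompleteSpace X] {C : X →L[ℂ] X}

theorem conv_pointwise (hM : ∀ t ≥ 0, ‖S.op t‖ ≤ M * Real.exp (ω * t)) (hω : ω < 0)
    (hC : ∀ t ≥ 0, ∀ x, S.op t (C x) = C (S.op t x)) (g : LineL2 X) (t : ℝ) :
    conv S (pointwise C g) t = C (conv S g t) := by
  rw [conv_congr_ae (coeFn_pointwise C g)]
  simp only [conv]
  rw [← ContinuousLinearMap.integral_comp_comm _ (integrable_conv hM hω (Lp.memLp g) t)]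
  exact setIntegral_congr_fun measurableSet_Ioi fun r hr => hC r (le_of_lt hr) _

omit [CompleteSpace X] in
/-- Convolution vanishes as long as the input does. -/
theorem conv_eq_zero {g : ℝ → X} (hg : ∀ᵐ t, t < 0 → g t = 0) {t : ℝ} (ht : t ≤ 0) :
    conv S g t = 0 := by
  refine integral_eq_zero_of_ae ?_
  filter_upwards [ae_restrict_of_ae (ae_comp_sub_left hg t), ae_restrict_mem measurableSet_Ioi]
    with r h hr
  rw [h (by linarith [mem_Ioi.1 hr]), map_zero, Pi.zero_apply]

/-- The convolution at a later time in terms of the later input. -/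
theorem conv_add_time (hM : ∀ t ≥ 0, ‖S.op t‖ ≤ M * Real.exp (ω * t)) (hω : ω < 0)
    {g g' : LineL2 X} {s t : ℝ} (hs : 0 ≤ s) (h0 : ∀ᵐ r, r < 0 → g' r = 0)
    (h1 : ∀ᵐ r, 0 < r → g' r = g (r + t)) :
    conv S g (s + t) = S.op s (conv S g t) + conv S g' s := by
  have hi := integrable_conv hM hω (Lp.memLp g) (s + t)
  have hi' := integrable_conv hM hω (Lp.memLp g') s
  -- Delays `r > s` read the input before time `t` and reproduce `S(s)` of the earlier convolution;
  -- delays `r ≤ s` read the input after `t`, which is `g'`.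
  have hu : Ioi (0 : ℝ) = Ioi s ∪ Ioc 0 s := by
    rw [union_comm, Ioc_union_Ioi_eq_Ioi hs]
  have hd : Disjoint (Ioi s) (Ioc 0 s) :=
    disjoint_left.2 fun r h h' => absurd h'.2 (not_le.2 h)
  have hs1 : Ioi s ⊆ Ioi (0 : ℝ) := Ioi_subset_Ioi hs
  have hs2 : Ioc 0 s ⊆ Ioi (0 : ℝ) := Ioc_subset_Ioi_self
  have hspl : ∀ {f : ℝ → X}, IntegrableOn f (Ioi 0) →
      ∫ r in Ioi (0 : ℝ), f r = (∫ r in Ioi s, f r) + ∫ r in Ioc 0 s, f r := fun hf => by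
    rw [hu, setIntegral_union hd measurableSet_Ioc (hf.mono_set hs1) (hf.mono_set hs2)]
  have e1 : ∫ r in Ioi s, S.op r (g (s + t - r)) = S.op s (conv S g t) := by
    rw [conv, ← ContinuousLinearMap.integral_comp_comm _ (integrable_conv hM hω (Lp.memLp g) t)]
    have e := (measurePreserving_add_right (volume : Measure ℝ) s).setIntegral_preimage_emb
      (measurableEmbedding_addRight s) (fun r => S.op r (g (s + t - r))) (Ioi s)
    have hpre : (fun r : ℝ => r + s) ⁻¹' Ioi s = Ioi 0 := by ext; simp
    rw [← e, hpre]
    refine setIntegral_congr_fun measurableSet_Ioi fun r hr => ?_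
    rw [add_comm r s, S.op_add hs (le_of_lt hr), add_sub_add_left_eq_sub]
  have e2 : ∫ r in Ioi s, S.op r (g' (s - r)) = 0 := by
    refine integral_eq_zero_of_ae ?_
    filter_upwards [ae_restrict_of_ae (ae_comp_sub_left h0 s), ae_restrict_mem measurableSet_Ioi]
      with r h hr
    rw [h (by linarith [mem_Ioi.1 hr]), map_zero, Pi.zero_apply]
  have e3 : ∫ r in Ioc 0 s, S.op r (g (s + t - r)) = ∫ r in Ioc 0 s, S.op r (g' (s - r)) := by
    -- The endpoint `r = s` reads `g'` at time zero, where nothing is assumed.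
    rw [integral_Ioc_eq_integral_Ioo, integral_Ioc_eq_integral_Ioo]
    refine integral_congr_ae ?_
    filter_upwards [ae_restrict_of_ae (ae_comp_sub_left h1 s), ae_restrict_mem measurableSet_Ioo]
      with r h hr
    rw [h (by linarith [hr.2]), sub_add_eq_add_sub]
  rw [conv, hspl hi, e1, e3]
  congr 1
  rw [conv, hspl hi', e2, zero_add]

/-- `W` is the trajectory of the delay equation with initial value `v = (x, f)`: it is `f` on
`[-1, 0]`, satisfies the variation of constants formula on `(0, ∞)`, and is continued by zero. -/
structure IsTrajectory (S : C0Semigroup X) (C : X →L[ℂ] X) (v : DelaySpace X) (W : LineL2 X) :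
    Prop where
  past : ∀ᵐ t, t < -1 → W t = 0
  history : ∀ᵐ t, t ∈ Icc (-1 : ℝ) 0 → W t = v.snd t
  future : ∀ᵐ t, 0 < t → W t = S.op t v.fst + conv S (delayed C W) t

omit [CompleteSpace X] in
theorem delayed_eq_zero {W : LineL2 X} (h : ∀ᵐ t, t < -1 → W t = 0) :
    ∀ᵐ t, t < 0 → delayed C W t = 0 := by
  filter_upwards [coeFn_delayed C W, ae_comp_add h (-1)] with t h1 h2 ht
  rw [h1, sub_eq_add_neg, h2 (by linarith), map_zero]

omit [CompleteSpace X] in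
/-- The initial data as an element of `L²(ℝ, X)`: the history, followed by the orbit of the
undelayed equation. -/
theorem exists_initial (hM : ∀ t ≥ 0, ‖S.op t‖ ≤ M * Real.exp (ω * t)) (hω : ω < 0) :
    ∃ J : DelaySpace X →L[ℂ] LineL2 X, ∀ v : DelaySpace X,
      J v =ᵐ[volume] fun t => (Icc (-1 : ℝ) 0).indicator (v.snd) t +
        (Ioi (0 : ℝ)).indicator (fun r => S.op r v.fst) t := by
  have m1 : ∀ f : HistL2 X, MemLp ((Icc (-1 : ℝ) 0).indicator f) 2 volume := fun f =>
    (memLp_indicator_iff_restrict measurableSet_Icc).2 (Lp.memLp f)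
  let J₁ : HistL2 X →L[ℂ] LineL2 X := LinearMap.mkContinuous
    { toFun := fun f => (m1 f).toLp
      map_add' := fun f g => by
        rw [← MemLp.toLp_add]
        refine MemLp.toLp_congr _ _ ?_
        have := (ae_restrict_iff' measurableSet_Icc).1 (Lp.coeFn_add f g)
        filter_upwards [this] with t ht
        by_cases h : t ∈ Icc (-1 : ℝ) 0
        · simp only [Pi.add_apply, indicator_of_mem h, ht h]
        · simp only [Pi.add_apply, indicator_of_notMem h, add_zero]
      map_smul' := fun c f => by
        rw [RingHom.id_apply, ← MemLp.toLp_const_smul]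
        refine MemLp.toLp_congr _ _ ?_
        have := (ae_restrict_iff' measurableSet_Icc).1 (Lp.coeFn_smul c f)
        filter_upwards [this] with t ht
        by_cases h : t ∈ Icc (-1 : ℝ) 0
        · simp only [Pi.smul_apply, indicator_of_mem h, ht h]
        · simp only [Pi.smul_apply, indicator_of_notMem h, smul_zero] } 1 fun f => by
      change ‖(m1 f).toLp‖ ≤ _
      rw [Lp.norm_toLp, eLpNorm_indicator_eq_eLpNorm_restrict measurableSet_Icc, one_mul]
      rfl
  have b2 : ∀ x : X, ∀ᵐ t ∂(volume.restrict (Ioi (0 : ℝ))),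
      ‖S.op t x‖ ≤ ‖x‖ * ‖M * Real.exp (ω * t)‖ := fun x => by
    filter_upwards [ae_restrict_mem measurableSet_Ioi] with t ht
    refine ((S.op t).le_of_opNorm_le (hM t (le_of_lt ht)) x).trans ?_
    rw [mul_comm]
    gcongr
    exact le_abs_self _
  have me : MemLp (fun t => M * Real.exp (ω * t)) 2 (volume.restrict (Ioi (0 : ℝ))) := by
    have hec : Continuous fun t => M * Real.exp (ω * t) := by fun_prop
    refine (memLp_two_iff_integrable_sq hec.aestronglyMeasurable).2 ?_
    have : (fun r => (M * Real.exp (ω * r)) ^ 2) = fun r => M ^ 2 * Real.exp ((2 * ω) * r) := by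
      ext r
      rw [mul_pow, ← Real.exp_nat_mul]
      congr 2
      push_cast
      ring
    rw [this]
    exact (integrableOn_exp_mul_Ioi (by linarith) 0).const_mul _
  have m2 : ∀ x : X, MemLp ((Ioi (0 : ℝ)).indicator fun r => S.op r x) 2 volume := fun x =>
    (memLp_indicator_iff_restrict measurableSet_Ioi).2
      (me.of_le_mul (S.continuous_op_apply x).aestronglyMeasurable (b2 x))
  let J₂ : X →L[ℂ] LineL2 X := LinearMap.mkContinuous
    { toFun := fun x => (m2 x).toLp
      map_add' := fun x y => by
        rw [← MemLp.toLp_add]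
        refine MemLp.toLp_congr _ _ (Eventually.of_forall fun t => ?_)
        simp only [map_add, Pi.add_apply, indicator_add]
      map_smul' := fun c x => by
        rw [RingHom.id_apply, ← MemLp.toLp_const_smul]
        refine MemLp.toLp_congr _ _ (Eventually.of_forall fun t => ?_)
        simp only [map_smul, Pi.smul_apply, indicator_smul_apply] }
    (eLpNorm (fun t => M * Real.exp (ω * t)) 2 (volume.restrict (Ioi (0 : ℝ)))).toReal
    fun x => by
      change ‖(m2 x).toLp‖ ≤ _
      rw [Lp.norm_toLp, eLpNorm_indicator_eq_eLpNorm_restrict measurableSet_Ioi, mul_comm]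
      have := eLpNorm_le_mul_eLpNorm_of_ae_le_mul (b2 x) 2
      refine (ENNReal.toReal_mono (ENNReal.mul_ne_top ENNReal.ofReal_ne_top me.2.ne) this).trans_eq
        ?_
      rw [ENNReal.toReal_mul, ENNReal.toReal_ofReal (norm_nonneg x)]
  refine ⟨J₁.comp (WithLp.sndL 2 ℂ X (HistL2 X)) + J₂.comp (WithLp.fstL 2 ℂ X (HistL2 X)),
    fun v => ?_⟩
  filter_upwards [(m1 v.snd).coeFn_toLp, (m2 v.fst).coeFn_toLp,
    Lp.coeFn_add (J₁ v.snd) (J₂ v.fst)] with t h1 h2 h3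
  exact h3.trans (congrArg₂ (· + ·) h1 h2)

omit [CompleteSpace X] in
/-- Existence, uniqueness and continuous dependence of trajectories, if the geometric series of the
delay convolution operator converges. -/
theorem exists_trajectory (hM : ∀ t ≥ 0, ‖S.op t‖ ≤ M * Real.exp (ω * t)) (hω : ω < 0)
    {K : LineL2 X →L[ℂ] LineL2 X} (hK : ∀ g, K g =ᵐ[volume] conv S g)
    (hsum : Summable fun n : ℕ => (K.comp (delayed C)) ^ n) :
    ∃ U : DelaySpace X →L[ℂ] LineL2 X, (∀ v, IsTrajectory S C v (U v)) ∧
      ∀ v W, IsTrajectory S C v W → W = U v := by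
  obtain ⟨J, hJ⟩ := exists_initial (X := X) hM hω
  set L := K.comp (delayed C) with hL
  set G := ∑' n : ℕ, L ^ n with hG
  have hLW : ∀ W, L W =ᵐ[volume] conv S (delayed C W) := fun W => hK _
  have hfix : ∀ v, G (J v) = J v + L (G (J v)) := fun v => by
    have := congrArg (fun T : LineL2 X →L[ℂ] LineL2 X => T (J v)) hsum.one_sub_mul_tsum_pow
    simp only [mul_apply_eq_comp, sub_apply,
      one_apply_eq_self] at this
    exact (eq_add_of_sub_eq this)
  have huniq : ∀ v W, W = J v + L W → W = G (J v) := fun v W hW => by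
    have := congrArg (fun T : LineL2 X →L[ℂ] LineL2 X => T W) hsum.tsum_pow_mul_one_sub
    simp only [mul_apply_eq_comp, sub_apply,
      one_apply_eq_self] at this
    rw [← this, sub_eq_of_eq_add hW]
  -- Vanishing before time `-1` becomes membership in the kernel of a bounded operator, a closed
  -- condition that survives the infinite sum.
  have hker : ∀ W : LineL2 X, restr X (Iio (-1)) W = 0 ↔ ∀ᵐ t, t < -1 → W t = 0 := fun W => by
    rw [Lp.eq_zero_iff_ae_eq_zero]
    constructor
    · intro h
      refine (ae_restrict_iff' measurableSet_Iio).1 ?_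
      filter_upwards [h, coeFn_restr (Iio (-1)) W] with t h1 h2
      rw [← h2, h1, Pi.zero_apply]
    · intro h
      filter_upwards [(ae_restrict_iff' measurableSet_Iio).2 h, coeFn_restr (Iio (-1)) W]
        with t h1 h2
      rw [h2, h1, Pi.zero_apply]
  have hinv : ∀ W, restr X (Iio (-1)) W = 0 → restr X (Iio (-1)) (L W) = 0 := fun W hW => by
    rw [hker] at hW ⊢
    filter_upwards [hLW W] with t h ht
    rw [h, conv_eq_zero (delayed_eq_zero hW) (by linarith)]
  have hJ0 : ∀ v, restr X (Iio (-1)) (J v) = 0 := fun v => by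
    rw [hker]
    filter_upwards [hJ v] with t h ht
    rw [h, indicator_of_notMem (fun h => by linarith [h.1]),
      indicator_of_notMem (fun h => by linarith [mem_Ioi.1 h]), add_zero]
  -- Every term of the Neumann series vanishes before `-1`: `J v` does, and `L` preserves this by
  -- causality.
  have hpast : ∀ v, restr X (Iio (-1)) (G (J v)) = 0 := fun v => by
    have h1 : ∀ n : ℕ, restr X (Iio (-1)) ((L ^ n) (J v)) = 0 := fun n => by
      induction n with
      | zero => exact hJ0 v
      | succ n ih => rw [pow_succ']; exact hinv _ ih
    have h2 := (hsum.hasSum.mapL (ContinuousLinearMap.apply ℂ (LineL2 X) (J v))).mapL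
      (restr X (Iio (-1)))
    simp only [ContinuousLinearMap.apply_apply, h1] at h2
    exact h2.unique hasSum_zero
  refine ⟨G.comp J, fun v => ?_, fun v W hW => huniq v W (Lp.ext ?_)⟩
  · have hp := (hker _).1 (hpast v)
    have e : ∀ᵐ t, G (J v) t = (Icc (-1 : ℝ) 0).indicator v.snd t +
        (Ioi (0 : ℝ)).indicator (fun r => S.op r v.fst) t
          + conv S (delayed C (G (J v))) t := by
      filter_upwards [hJ v, hLW (G (J v)), Lp.coeFn_add (J v) (L (G (J v)))] with t h1 h2 h3
      conv_lhs => rw [hfix]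
      rw [h3, Pi.add_apply, h1, h2]
    refine ⟨hp, ?_, ?_⟩
    · filter_upwards [e] with t ht h
      rw [ContinuousLinearMap.comp_apply, ht, indicator_of_mem h,
        indicator_of_notMem (fun h' => by linarith [mem_Ioi.1 h', h.2]),
        conv_eq_zero (delayed_eq_zero hp) h.2, add_zero, add_zero]
    · filter_upwards [e] with t ht h
      rw [ContinuousLinearMap.comp_apply, ht, indicator_of_mem (mem_Ioi.2 h),
        indicator_of_notMem (fun h' => by linarith [h'.2]), zero_add]
  · filter_upwards [hJ v, hLW W, Lp.coeFn_add (J v) (L W), hW.past, hW.history, hW.future]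
      with t h1 h2 h3 k1 k2 k3
    rw [h3, Pi.add_apply, h1, h2]
    rcases lt_or_ge t (-1) with ht | ht
    · rw [k1 ht, conv_eq_zero (delayed_eq_zero hW.past) (by linarith),
        indicator_of_notMem (fun h => by linarith [h.1]),
        indicator_of_notMem (fun h => by linarith [mem_Ioi.1 h]), add_zero, add_zero]
    rcases le_or_gt t 0 with ht' | ht'
    · rw [k2 ⟨ht, ht'⟩, conv_eq_zero (delayed_eq_zero hW.past) ht', indicator_of_mem (mem_Icc.2 ⟨ht, ht'⟩),
        indicator_of_notMem (fun h => by linarith [mem_Ioi.1 h]), add_zero, add_zero]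
    · rw [k3 ht', indicator_of_mem (mem_Ioi.2 ht'),
        indicator_of_notMem (fun h => by linarith [h.2]), zero_add]

/-- Convergence of the geometric series of the delay convolution operator. -/
theorem summable_delay_pow (hM : ∀ t ≥ 0, ‖S.op t‖ ≤ M * Real.exp (ω * t)) (hω : ω < 0)
    (hC : ∀ t ≥ 0, ∀ x, S.op t (C x) = C (S.op t x))
    {K : LineL2 X →L[ℂ] LineL2 X} (hK : ∀ g, K g =ᵐ[volume] conv S g) {m : ℝ≥0}
    (hm : ‖K‖ ≤ m) (hr : spectralRadius ℂ C < 1 / (m : ℝ≥0∞)) :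
    Summable fun n : ℕ => (K.comp (delayed C)) ^ n := by
  have c1 : Commute K (pointwise C) := by
    ext1 g
    refine Lp.ext ?_
    simp only [mul_apply_eq_comp]
    filter_upwards [hK (pointwise C g), coeFn_pointwise C (K g), hK g] with t h1 h2 h3
    rw [h1, h2, h3, conv_pointwise hM hω hC]
  have c2 : Commute K (transl X (-1)) := by
    ext1 g
    refine Lp.ext ?_
    simp only [mul_apply_eq_comp]
    filter_upwards [hK (transl X (-1) g), coeFn_transl (-1) (K g), ae_comp_add (hK g) (-1)]
      with t h1 h2 h3
    rw [h1, h2, h3, conv_transl]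
  -- Separating the powers brings in `‖C ^ n‖` rather than `‖C‖ ^ n`; this is why the spectral
  -- radius, and not the norm, is the right quantity.
  have hpow : ∀ n : ℕ, (K.comp (delayed C)) ^ n =
      K ^ n * (pointwise (C ^ n) * transl X (-1) ^ n) := fun n => by
    change (K * (pointwise C * transl X (-1))) ^ n = _
    rw [(c1.mul_right c2).mul_pow, (pointwise_transl_comm C (-1)).mul_pow, pointwise_pow]
  have hnorm : ∀ n : ℕ, 0 < n → ‖(K.comp (delayed C)) ^ n‖ ≤ (m : ℝ) ^ n * ‖C ^ n‖ := fun n hn => by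
    have ht : ‖transl X (-1)‖ ≤ 1 := ContinuousLinearMap.opNorm_le_bound _ zero_le_one fun g => by
      rw [norm_transl, one_mul]
    rw [hpow]
    calc _ ≤ ‖K ^ n‖ * (‖pointwise (C ^ n)‖ * ‖transl X (-1) ^ n‖) :=
          (norm_mul_le _ _).trans (by gcongr; exact norm_mul_le _ _)
      _ ≤ (m : ℝ) ^ n * (‖C ^ n‖ * 1) := by
          gcongr
          · exact (norm_pow_le' K hn).trans (pow_le_pow_left₀ (norm_nonneg _) hm n)
          · exact ContinuousLinearMap.norm_compLpL_le _
          · exact (norm_pow_le' _ hn).trans (pow_le_one₀ (norm_nonneg _) ht)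
      _ = _ := by rw [mul_one]
  -- With `q` strictly between `r(C)` and `1/m`, Gelfand's formula gives `‖C ^ n‖ ≤ q ^ n`
  -- eventually, and `q m < 1` is the ratio of a geometric majorant. The case `m = 0` is included.
  obtain ⟨q, hq1, hq2⟩ := ENNReal.lt_iff_exists_nnreal_btwn.1 hr
  have hqm : q * m < 1 := by
    rw [ENNReal.lt_div_iff_mul_lt (Or.inr (by simp)) (Or.inl (by simp))] at hq2
    exact_mod_cast hq2
  have hev := (spectrum.pow_nnnorm_pow_one_div_tendsto_nhds_spectralRadius C).eventually_lt_const
    hq1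
  refine (summable_geometric_of_lt_one (q * m).2 hqm).of_norm_bounded_eventually_nat ?_
  filter_upwards [hev, eventually_gt_atTop 0] with n hn hn0
  have h1 : ‖C ^ n‖ ≤ (q : ℝ) ^ n := by
    have := ENNReal.rpow_le_rpow hn.le (Nat.cast_nonneg (α := ℝ) n)
    rw [← ENNReal.rpow_mul, one_div, inv_mul_cancel₀ (by positivity), ENNReal.rpow_one,
      ENNReal.rpow_natCast] at this
    exact_mod_cast this
  refine (hnorm n hn0).trans ?_
  calc _ ≤ (m : ℝ) ^ n * (q : ℝ) ^ n := by gcongr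
    _ = _ := by rw [← mul_pow, mul_comm]; rfl

end Trajectory

/-! ### The delay semigroup -/

section DelaySemigroup

variable {X : Type*} [NormedAddCommGroup X] [NormedSpace ℂ X] [CompleteSpace X]
variable {S : C0Semigroup X} {M ω : ℝ} {C : X →L[ℂ] X}

section Shift

omit [CompleteSpace X]

/-- A translated function, cut off before time `-1`. -/
theorem exists_truncate (W : LineL2 X) (t : ℝ) : ∃ W' : LineL2 X,
    (∀ᵐ r, r < -1 → W' r = 0) ∧ ∀ᵐ r, -1 ≤ r → W' r = W (r + t) := by
  have hm : MemLp ((Ici (-1 : ℝ)).indicator (transl X t W)) 2 volume :=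
    (Lp.memLp (transl X t W)).indicator measurableSet_Ici
  refine ⟨hm.toLp, ?_, ?_⟩
  · filter_upwards [hm.coeFn_toLp] with r h hr
    rw [h, indicator_of_notMem (fun h' => by linarith [mem_Ici.1 h'])]
  · filter_upwards [hm.coeFn_toLp, coeFn_transl t W] with r h h' hr
    rw [h, indicator_of_mem (mem_Ici.2 hr), h']

theorem delayed_shift {W W' : LineL2 X} {t : ℝ} (h : ∀ᵐ r, -1 ≤ r → W' r = W (r + t)) :
    ∀ᵐ r, 0 < r → delayed C W' r = delayed C W (r + t) := by
  filter_upwards [coeFn_delayed C W', ae_comp_add (coeFn_delayed C W) t, ae_comp_add h (-1)]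
    with r h1 h2 h3 hr
  rw [h1, h2, sub_eq_add_neg, h3 (by linarith)]
  congr 2
  ring

end Shift

theorem conv_delayed_shift (hM : ∀ t ≥ 0, ‖S.op t‖ ≤ M * Real.exp (ω * t)) (hω : ω < 0)
    {W W' : LineL2 X} {s t : ℝ} (hs : 0 ≤ s) (h0 : ∀ᵐ r, r < -1 → W' r = 0)
    (h1 : ∀ᵐ r, -1 ≤ r → W' r = W (r + t)) :
    conv S (delayed C W) (s + t) =
      S.op s (conv S (delayed C W) t) + conv S (delayed C W') s :=
  conv_add_time hM hω hs (delayed_eq_zero h0) (delayed_shift h1)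

/-- The equation is autonomous: the truncated shift of a trajectory solves the variation of
constants formula with the state at time `t` as initial value. Together with uniqueness this yields
the semigroup law. -/
theorem IsTrajectory.shift (hM : ∀ t ≥ 0, ‖S.op t‖ ≤ M * Real.exp (ω * t)) (hω : ω < 0)
    {v v' : DelaySpace X} {W W' : LineL2 X} (hW : IsTrajectory S C v W) {t : ℝ} (ht : 0 ≤ t)
    (h0 : ∀ᵐ r, r < -1 → W' r = 0) (h1 : ∀ᵐ r, -1 ≤ r → W' r = W (r + t))
    (hfst : v'.fst = S.op t v.fst + conv S (delayed C W) t)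
    (hsnd : v'.snd =ᵐ[histMeasure] fun r => W (r + t)) : IsTrajectory S C v' W' where
  past := h0
  history := by
    filter_upwards [h1, (ae_restrict_iff' measurableSet_Icc).1 hsnd] with r h h' hr
    rw [h hr.1, h' hr]
  future := by
    filter_upwards [h1, ae_comp_add hW.future t] with r h h' hr
    rw [h (by linarith), h' (by linarith), conv_delayed_shift hM hω hr.le h0 h1, hfst, map_add,
      S.op_add hr.le ht, add_assoc]

/-- The semigroup of the delay equation: it maps the initial data to the pair of the present value
and the history segment of the trajectory. -/
theorem exists_delaySemigroup (hM : ∀ t ≥ 0, ‖S.op t‖ ≤ M * Real.exp (ω * t)) (hω : ω < 0)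
    {U : DelaySpace X →L[ℂ] LineL2 X} (hU : ∀ v, IsTrajectory S C v (U v))
    (huniq : ∀ v W, IsTrajectory S C v W → W = U v) :
    ∃ T : C0Semigroup (DelaySpace X), ∀ t ≥ 0, ∀ v,
      (T.op t v).fst = S.op t v.fst + conv S (delayed C (U v)) t ∧
      (T.op t v).snd = restr X (Icc (-1) 0) (transl X t (U v)) := by
  obtain ⟨k, hk⟩ := exists_convZero hM hω
  have hkt : ∀ (g : LineL2 X) t, k (transl X t g) = conv S g t := fun g t => by
    rw [hk, conv_transl, zero_add]
  -- The present value is taken from the continuous right-hand side of the variation of constants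
  -- formula, since the class `U v` has no value at a point.
  let P : ℝ → DelaySpace X →L[ℂ] X := fun t =>
    (S.op t).comp (WithLp.fstL 2 ℂ X (HistL2 X)) +
      k.comp ((transl X t).comp ((delayed C).comp U))
  let Q : ℝ → DelaySpace X →L[ℂ] HistL2 X := fun t =>
    (restr X (Icc (-1) 0)).comp ((transl X t).comp U)
  let T : ℝ → DelaySpace X →L[ℂ] DelaySpace X := fun t =>
    ((WithLp.prodContinuousLinearEquiv 2 ℂ X (HistL2 X)).symm :
      X × HistL2 X →L[ℂ] DelaySpace X).comp ((P t).prod (Q t))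
  have hT1 : ∀ t v, (T t v).fst = S.op t v.fst + conv S (delayed C (U v)) t := fun t v => by
    rw [← hkt]
    rfl
  have hT2 : ∀ t v, (T t v).snd = restr X (Icc (-1) 0) (transl X t (U v)) := fun t v => rfl
  have hT2' : ∀ t v, (T t v).snd =ᵐ[histMeasure] fun r => U v (r + t) := fun t v => by
    filter_upwards [coeFn_restr (Icc (-1) 0) (transl X t (U v)),
      ae_restrict_of_ae (coeFn_transl t (U v))] with r h1 h2
    rw [hT2, h1, h2]
  have hext : ∀ {v w : DelaySpace X}, v.fst = w.fst → v.snd = w.snd → v = w := fun h1 h2 =>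
    WithLp.ofLp_injective 2 (Prod.ext h1 h2)
  have hc : ∀ v, Continuous fun t => T t v := fun v => by
    refine (WithLp.prod_continuous_toLp 2 X (HistL2 X)).comp (Continuous.prodMk ?_ ?_)
    · exact (S.continuous_op_apply v.fst).add
        (k.continuous.comp (continuous_transl (delayed C (U v))))
    · exact (restr X (Icc (-1) 0)).continuous.comp (continuous_transl (U v))
  have hzero : T 0 = ContinuousLinearMap.id ℂ _ := by
    ext1 v
    refine hext ?_ (Lp.ext ?_)
    · rw [hT1, conv_eq_zero (delayed_eq_zero (hU v).past) le_rfl, add_zero, S.op_zero_apply]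
      rfl
    · filter_upwards [hT2' 0 v, (ae_restrict_iff' measurableSet_Icc).2 (hU v).history] with r h1 h2
      rw [h1, add_zero, h2]
      rfl
  have hadd : ∀ s ≥ 0, ∀ t ≥ 0, T (s + t) = (T s).comp (T t) := fun s hs t ht => by
    ext1 v
    obtain ⟨W, h0, h1⟩ := exists_truncate (U v) t
    -- Uniqueness of trajectories: restarting from the state at time `t` continues the same
    -- solution.
    have hW : W = U (T t v) :=
      huniq _ _ ((hU v).shift hM hω ht h0 h1 (hT1 t v) (hT2' t v))
    refine hext ?_ (Lp.ext ?_)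
    · change (T (s + t) v).fst = (T s (T t v)).fst
      rw [hT1, hT1 s, hT1 t, ← hW,
        conv_delayed_shift hM hω hs h0 h1, S.op_add hs ht, map_add, add_assoc]
    · have h1' := ae_restrict_of_ae (s := Icc (-1 : ℝ) 0) (ae_comp_add h1 s)
      filter_upwards [hT2' (s + t) v, hT2' s (T t v), h1', ae_restrict_mem measurableSet_Icc]
        with r k1 k2 k3 hr
      rw [k1, ContinuousLinearMap.comp_apply, k2, ← hW, k3 (by linarith [hr.1]), add_assoc]
  refine ⟨⟨fun t => T t, hzero, fun s t => ?_, fun v => (hc v).comp NNReal.continuous_coe⟩,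
    fun t ht v => ?_⟩
  · rw [NNReal.coe_add]
    exact hadd s s.2 t t.2
  · simp only [C0Semigroup.op, Real.coe_toNNReal t ht]
    exact ⟨hT1 t v, hT2 t v⟩

end DelaySemigroup

/-! ### Exponential stability -/

section Stability

theorem C0Semigroup.exists_exp_bound {X : Type*} [NormedAddCommGroup X] [NormedSpace ℂ X]
    {S : C0Semigroup X} (hS : S.growthBound < 0) :
    ∃ M ω : ℝ, ω < 0 ∧ ∀ t ≥ 0, ‖S.op t‖ ≤ M * Real.exp (ω * t) := by
  obtain ⟨w, ⟨ω, rfl, M, hM⟩, hw⟩ := sInf_lt_iff.1 hS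
  refine ⟨M, ω, by exact_mod_cast hw, fun t ht => ?_⟩
  simpa [C0Semigroup.op, ht] using hM t.toNNReal

/-- A bounded semigroup, one of whose operators has norm at most `1/2`, is exponentially stable. -/
theorem C0Semigroup.growthBound_neg_of_norm_le_half {E : Type*} [NormedAddCommGroup E]
    [NormedSpace ℂ E] {T : C0Semigroup E} {L : ℝ} (hL : ∀ t ≥ 0, ‖T.op t‖ ≤ L) {a : ℝ}
    (ha : 0 < a) (hT : ‖T.op a‖ ≤ 1 / 2) : T.growthBound < 0 := by
  have hL0 : 0 ≤ L := (norm_nonneg _).trans (hL 0 le_rfl)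
  have hn : ∀ (n : ℕ) (r : ℝ), 0 ≤ r → ‖T.op (n * a + r)‖ ≤ (1 / 2) ^ n * L := fun n => by
    induction n with
    | zero => intro r hr; simpa using hL r hr
    | succ n ih =>
      intro r hr
      have e : ((n + 1 : ℕ) : ℝ) * a + r = a + (n * a + r) := by push_cast; ring
      have e' : T.op (a + (n * a + r)) = (T.op a).comp (T.op (n * a + r)) := by
        ext1 v
        exact T.op_add ha.le (by positivity) v
      rw [e, e']
      refine (ContinuousLinearMap.opNorm_comp_le _ _).trans ?_
      calc _ ≤ 1 / 2 * ((1 / 2) ^ n * L) :=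
            mul_le_mul hT (ih r hr) (norm_nonneg _) (by norm_num)
        _ = _ := by ring
  have hlog : 0 < Real.log 2 := Real.log_pos one_lt_two
  have hω : -(Real.log 2 / a) < 0 := neg_lt_zero.2 (div_pos hlog ha)
  -- Halving in every period `a` gives the rate `-log 2 / a`; the factor `2` in `2 * L` pays for
  -- rounding `t / a` down.
  refine lt_of_le_of_lt (b := ((-(Real.log 2 / a) : ℝ) : EReal))
    (sInf_le ⟨_, rfl, 2 * L, fun t => ?_⟩) (by exact_mod_cast hω)
  rw [T.toFun_eq_op]
  have ht : (0 : ℝ) ≤ t := t.2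
  set n := ⌊(t : ℝ) / a⌋₊ with hn'
  have h1 : (n : ℝ) * a ≤ t := (le_div_iff₀ ha).1 (Nat.floor_le (div_nonneg ht ha.le))
  have h2 : (t : ℝ) / a < n + 1 := Nat.lt_floor_add_one _
  have h3 := hn n (t - n * a) (sub_nonneg.2 h1)
  rw [add_sub_cancel] at h3
  refine h3.trans ?_
  have e : ((1 : ℝ) / 2) ^ n = Real.exp (-(n * Real.log 2)) := by
    rw [Real.exp_neg, Real.exp_nat_mul, Real.exp_log two_pos, one_div, inv_pow]
  have e2 : 2 * L * Real.exp (-(Real.log 2 / a) * t) =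
      Real.exp (Real.log 2 + -(Real.log 2 / a) * t) * L := by
    rw [Real.exp_add, Real.exp_log two_pos]
    ring
  rw [e, e2]
  refine mul_le_mul_of_nonneg_right (Real.exp_le_exp.2 ?_) hL0
  have : Real.log 2 * (t / a) ≤ Real.log 2 * (n + 1) := by gcongr
  have e3 : -(Real.log 2 / a) * t = -(Real.log 2 * (t / a)) := by ring
  rw [e3]
  linarith

/-- Datko's criterion: a bounded semigroup with square integrable orbits is exponentially
stable. -/
theorem C0Semigroup.growthBound_neg_of_lintegral_le {E : Type*} [NormedAddCommGroup E]
    [NormedSpace ℂ E] {T : C0Semigroup E} {L : ℝ} (hL : ∀ t ≥ 0, ‖T.op t‖ ≤ L) {c : ℝ≥0}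
    (hc : ∀ v, ∫⁻ t in Ioi (0 : ℝ), ‖T.op t v‖ₑ ^ 2 ≤ c * ‖v‖ₑ ^ 2) : T.growthBound < 0 := by
  have hL0 : 0 ≤ L := (norm_nonneg _).trans (hL 0 le_rfl)
  lift L to ℝ≥0 using hL0
  -- For `s ≤ t`, boundedness gives `‖T(t)v‖ ≤ L ‖T(s)v‖`; integrate the squares over `s` in `(0,
  -- t]`.
  have key : ∀ t : ℝ, 0 < t → ∀ v, t * ‖T.op t v‖ ^ 2 ≤ L ^ 2 * c * ‖v‖ ^ 2 := fun t ht v => by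
    have h1 : ENNReal.ofReal t * ‖T.op t v‖ₑ ^ 2 ≤ L ^ 2 * (c * ‖v‖ₑ ^ 2) := by
      calc ENNReal.ofReal t * ‖T.op t v‖ₑ ^ 2 = ∫⁻ _ in Ioc 0 t, ‖T.op t v‖ₑ ^ 2 := by
            rw [setLIntegral_const, Real.volume_Ioc, sub_zero, mul_comm]
        _ ≤ ∫⁻ s in Ioc 0 t, (L : ℝ≥0∞) ^ 2 * ‖T.op s v‖ₑ ^ 2 := by
            refine setLIntegral_mono' measurableSet_Ioc fun s hs => ?_
            rw [← mul_pow]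
            gcongr
            have e : T.op t v = T.op (t - s) (T.op s v) := by
              rw [← T.op_add (sub_nonneg.2 hs.2) hs.1.le, sub_add_cancel]
            rw [e]
            have := (T.op (t - s)).le_of_opNorm_le (hL _ (sub_nonneg.2 hs.2)) (T.op s v)
            rw [enorm_eq_nnnorm, enorm_eq_nnnorm, ← ENNReal.coe_mul, ENNReal.coe_le_coe]
            exact this
        _ = (L : ℝ≥0∞) ^ 2 * ∫⁻ s in Ioc 0 t, ‖T.op s v‖ₑ ^ 2 :=
            lintegral_const_mul' _ _ (by finiteness)
        _ ≤ _ := by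
            gcongr
            exact (lintegral_mono_set Ioc_subset_Ioi_self).trans (hc v)
    have h2 := ENNReal.toReal_mono (by finiteness) h1
    simp only [ENNReal.toReal_mul, ENNReal.toReal_pow, toReal_enorm, ENNReal.coe_toReal,
      ENNReal.toReal_ofReal ht.le] at h2
    linarith
  -- At this time `key` yields `‖T(a)v‖² ≤ ‖v‖² / 4`; the summand `1` keeps the time positive when
  -- `L ^ 2 * c = 0`.
  have ha : (0 : ℝ) < 4 * (L ^ 2 * c) + 1 := by positivity
  refine growthBound_neg_of_norm_le_half hL ha
    (ContinuousLinearMap.opNorm_le_bound _ (by norm_num) fun v => ?_)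
  refine abs_le_of_sq_le_sq' ?_ (by positivity) |>.2
  have h := key _ ha v
  have h3 : (0 : ℝ) ≤ L ^ 2 * c := by positivity
  have h4 := sq_nonneg ‖T.op (4 * (L ^ 2 * c) + 1) v‖
  have h5 := sq_nonneg ‖v‖
  by_contra hlt
  rw [not_le] at hlt
  nlinarith

variable {X : Type*} [NormedAddCommGroup X] [NormedSpace ℂ X]

omit [NormedSpace ℂ X] in
theorem lintegral_enorm_sq {α : Type*} [MeasurableSpace α] {μ : Measure α} (g : Lp X 2 μ) :
    ∫⁻ t, ‖g t‖ₑ ^ 2 ∂μ = ‖g‖ₑ ^ 2 := by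
  have := eLpNorm_nnreal_pow_eq_lintegral (f := g) (μ := μ) (p := 2) (by norm_num)
  rw [Lp.enorm_def]
  simpa using this.symm

omit [NormedSpace ℂ X] in
theorem norm_delaySpace_le (v : DelaySpace X) : ‖v‖ ≤ ‖v.fst‖ + ‖v.snd‖ := by
  refine abs_le_of_sq_le_sq' ?_ (by positivity) |>.2
  rw [WithLp.prod_norm_sq_eq_of_L2]
  nlinarith [norm_nonneg v.fst, norm_nonneg v.snd]

omit [NormedSpace ℂ X] in
theorem enorm_sq_delaySpace (v : DelaySpace X) : ‖v‖ₑ ^ 2 = ‖v.fst‖ₑ ^ 2 + ‖v.snd‖ₑ ^ 2 := by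
  have := WithLp.prod_norm_sq_eq_of_L2 v
  simp only [← ofReal_norm]
  rw [← ENNReal.ofReal_pow (norm_nonneg _), this, ENNReal.ofReal_add (by positivity)
    (by positivity), ENNReal.ofReal_pow (norm_nonneg _), ENNReal.ofReal_pow (norm_nonneg _)]

/-- The square integral of the history segments. -/
theorem lintegral_restr_transl_le (W : LineL2 X) :
    ∫⁻ t in Ioi (0 : ℝ), ‖restr X (Icc (-1) 0) (transl X t W)‖ₑ ^ 2 ≤ ‖W‖ₑ ^ 2 := by
  have e1 : ∀ t, ‖restr X (Icc (-1) 0) (transl X t W)‖ₑ ^ 2 =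
      ∫⁻ r in Icc (-1 : ℝ) 0, ‖W (r + t)‖ₑ ^ 2 := fun t => by
    rw [← lintegral_enorm_sq]
    refine lintegral_congr_ae ?_
    filter_upwards [coeFn_restr (Icc (-1) 0) (transl X t W),
      ae_restrict_of_ae (coeFn_transl t W)] with r h1 h2
    rw [h1, h2]
  simp only [e1]
  refine (setLIntegral_le_lintegral _ _).trans ?_
  have hm : Measurable fun p : ℝ × ℝ => ‖W (p.2 + p.1)‖ₑ ^ 2 :=
    (((Lp.stronglyMeasurable W).enorm).comp (measurable_snd.add measurable_fst)).pow_const 2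
  rw [lintegral_lintegral_swap hm.aemeasurable]
  have e2 : ∀ r : ℝ, ∫⁻ t, ‖W (r + t)‖ₑ ^ 2 = ‖W‖ₑ ^ 2 := fun r => by
    rw [lintegral_add_left_eq_self (fun t => ‖W t‖ₑ ^ 2) r, lintegral_enorm_sq]
  simp only [e2, setLIntegral_const, Real.volume_Icc]
  simp

variable {S : C0Semigroup X} {M ω : ℝ} {C : X →L[ℂ] X}
  {U : DelaySpace X →L[ℂ] LineL2 X} {T : C0Semigroup (DelaySpace X)}

/-- The three summands of the bound come from the free orbit, the convolution at a point and the
history segment, each uniform in `t`. -/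
theorem exists_norm_delaySemigroup_le (hM : ∀ t ≥ 0, ‖S.op t‖ ≤ M * Real.exp (ω * t))
    (hω : ω < 0)
    (hT : ∀ t ≥ 0, ∀ v, (T.op t v).fst = S.op t v.fst + conv S (delayed C (U v)) t ∧
      (T.op t v).snd = restr X (Icc (-1) 0) (transl X t (U v))) :
    ∃ L : ℝ, ∀ t ≥ 0, ‖T.op t‖ ≤ L := by
  obtain ⟨κ, hκ0, hκ⟩ := exists_norm_conv_le hM hω
  have hM0 : 0 ≤ M := by simpa using (norm_nonneg _).trans (hM 0 le_rfl)
  refine ⟨M + κ * (‖delayed C‖ * ‖U‖) + ‖restr X (Icc (-1) 0)‖ * ‖U‖, fun t ht =>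
    ContinuousLinearMap.opNorm_le_bound _ (by positivity) fun v => ?_⟩
  obtain ⟨h1, h2⟩ := hT t ht v
  have hv1 : ‖v.fst‖ ≤ ‖v‖ := WithLp.norm_fst_le _ v
  have hSt : ‖S.op t‖ ≤ M := by
    refine (hM t ht).trans (mul_le_of_le_one_right hM0 (Real.exp_le_one_iff.2 ?_))
    exact mul_nonpos_of_nonpos_of_nonneg hω.le ht
  refine (norm_delaySpace_le _).trans ?_
  rw [h1, h2]
  calc _ ≤ (M * ‖v‖ + κ * (‖delayed C‖ * (‖U‖ * ‖v‖))) + ‖restr X (Icc (-1) 0)‖ * (‖U‖ * ‖v‖) := by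
        refine add_le_add ((norm_add_le _ _).trans (add_le_add ?_ ?_)) ?_
        · exact ((S.op t).le_of_opNorm_le hSt _).trans (by gcongr)
        · refine (hκ _ t).trans ?_
          gcongr
          exact ((delayed C).le_opNorm _).trans (by gcongr; exact U.le_opNorm v)
        · refine ((restr X (Icc (-1) 0)).le_opNorm _).trans ?_
          rw [norm_transl]
          gcongr
          exact U.le_opNorm v
    _ = _ := by ring

/-- For almost every `t > 0` the present value is the trajectory itself, so both components have
square integral at most `‖U v‖²`. This is Datko's hypothesis with constant `2 ‖U‖²`. -/
theorem growthBound_delaySemigroup_neg (hM : ∀ t ≥ 0, ‖S.op t‖ ≤ M * Real.exp (ω * t))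
    (hω : ω < 0) (hU : ∀ v, IsTrajectory S C v (U v))
    (hT : ∀ t ≥ 0, ∀ v, (T.op t v).fst = S.op t v.fst + conv S (delayed C (U v)) t ∧
      (T.op t v).snd = restr X (Icc (-1) 0) (transl X t (U v))) :
    T.growthBound < 0 := by
  obtain ⟨L, hL⟩ := exists_norm_delaySemigroup_le hM hω hT
  refine C0Semigroup.growthBound_neg_of_lintegral_le (c := 2 * ‖U‖₊ ^ 2) hL fun v => ?_
  have hUv : ‖U v‖ₑ ≤ ‖U‖₊ * ‖v‖ₑ := by
    rw [enorm_eq_nnnorm, enorm_eq_nnnorm, ← ENNReal.coe_mul, ENNReal.coe_le_coe]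
    exact U.le_opNorm v
  have e : ∀ᵐ t ∂(volume.restrict (Ioi (0 : ℝ))), ‖T.op t v‖ₑ ^ 2 =
      ‖U v t‖ₑ ^ 2 + ‖restr X (Icc (-1) 0) (transl X t (U v))‖ₑ ^ 2 := by
    filter_upwards [(ae_restrict_iff' measurableSet_Ioi).2 (hU v).future,
      ae_restrict_mem measurableSet_Ioi] with t h ht
    obtain ⟨h1, h2⟩ := hT t (le_of_lt ht) v
    rw [enorm_sq_delaySpace, h1, h2, h]
  rw [lintegral_congr_ae e,
    lintegral_add_left ((Lp.stronglyMeasurable (U v)).enorm.pow_const 2)]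
  calc _ ≤ ‖U v‖ₑ ^ 2 + ‖U v‖ₑ ^ 2 := by
        gcongr
        · exact (setLIntegral_le_lintegral _ _).trans (lintegral_enorm_sq (U v)).le
        · exact lintegral_restr_transl_le (U v)
    _ = 2 * ‖U v‖ₑ ^ 2 := (two_mul _).symm
    _ ≤ 2 * (‖U‖₊ * ‖v‖ₑ) ^ 2 := by gcongr
    _ = _ := by push_cast; ring

end Stability

/-! ### The generator of the delay semigroup -/

section HistoryCalculus

variable {X : Type*} [NormedAddCommGroup X] [NormedSpace ℂ X] [CompleteSpace X]

theorem weakDeriv_eq {f : W12 X} {g : HistL2 X} (h : IsWeakDeriv (f : HistL2 X) g) :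
    weakDeriv f = g :=
  IsWeakDeriv.unique (Exists.choose_spec f.2) h

theorem isWeakDeriv_weakDeriv (f : W12 X) : IsWeakDeriv (f : HistL2 X) (weakDeriv f) :=
  Exists.choose_spec f.2

theorem pointEval_eq {f : W12 X} {u : ℝ → X} (h : IsContRep (f : HistL2 X) u)
    (σ : Icc (-1 : ℝ) 0) : pointEval σ f = u σ :=
  (exists_isContRep f).choose_spec.eqOn h σ.2

/-- The primitive of the weak derivative is a continuous representative. -/
theorem IsWeakDeriv.exists_isContRep {f g : HistL2 X} (h : IsWeakDeriv f g) :
    ∃ c : X, IsContRep f fun σ => c + ∫ s in (-1)..σ, g s := by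
  obtain ⟨c, hc⟩ := h.exists_primitive
  exact ⟨c, continuousOn_const.add (continuousOn_primitive_hist (integrable_histL2 g)), hc⟩

omit [CompleteSpace X]

instance : IsProbabilityMeasure histMeasure :=
  ⟨by rw [Measure.restrict_apply_univ, Real.volume_Icc]; simp⟩

/-- Integration over `[-1, 0]` against a continuous weight is continuous on `L²`. -/
theorem tendsto_integral_smul_hist {ι : Type*} {l : Filter ι} {F : ι → HistL2 X} {f : HistL2 X}
    (h : Tendsto F l (𝓝 f)) {φ : ℝ → ℝ} (hφ : Continuous φ) :
    Tendsto (fun i => ∫ σ in Icc (-1 : ℝ) 0, φ σ • F i σ) l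
      (𝓝 (∫ σ in Icc (-1 : ℝ) 0, φ σ • f σ)) := by
  obtain ⟨c, hc⟩ := isCompact_Icc.exists_bound_of_continuousOn (s := Icc (-1 : ℝ) 0)
    hφ.continuousOn
  have hc0 : 0 ≤ c := (norm_nonneg _).trans (hc 0 (by norm_num))
  let ℓ : HistL2 X →ₗ[ℂ] X :=
    { toFun := fun g => ∫ σ in Icc (-1 : ℝ) 0, φ σ • g σ
      map_add' := fun g g' => by
        rw [← integral_add (integrable_smul_histL2 hφ g) (integrable_smul_histL2 hφ g')]
        refine integral_congr_ae ?_
        filter_upwards [Lp.coeFn_add g g'] with σ hσ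
        rw [hσ, Pi.add_apply, smul_add]
      map_smul' := fun a g => by
        rw [RingHom.id_apply, ← integral_smul]
        refine integral_congr_ae ?_
        filter_upwards [Lp.coeFn_smul a g] with σ hσ
        rw [hσ, Pi.smul_apply, smul_comm] }
  have hb : ∀ g, ‖ℓ g‖ ≤ c * ‖g‖ := fun g => by
    have h1 : ‖ℓ g‖ ≤ ∫ σ in Icc (-1 : ℝ) 0, c * ‖g σ‖ := by
      refine norm_integral_le_of_norm_le ((integrable_histL2 g).norm.const_mul c) ?_
      filter_upwards [ae_restrict_mem measurableSet_Icc] with σ hσ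
      rw [norm_smul]
      gcongr
      exact hc σ hσ
    refine h1.trans ?_
    rw [integral_const_mul]
    gcongr
    rw [integral_norm_eq_lintegral_enorm (Lp.aestronglyMeasurable g),
      ← eLpNorm_one_eq_lintegral_enorm, Lp.norm_def]
    -- On a probability space the `L¹` norm is at most the `L²` norm.
    exact ENNReal.toReal_mono (Lp.eLpNorm_ne_top g)
      (eLpNorm_le_eLpNorm_of_exponent_le (by norm_num) (Lp.aestronglyMeasurable g))
  exact ((ℓ.mkContinuous c hb).continuous.tendsto f).comp h

/-- Averages over short intervals converge to the value of a continuous representative. -/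
theorem tendsto_average [CompleteSpace X] {p W : ℝ → X} (hp : Continuous p) {a δ : ℝ} (hδ : 0 < δ)
    (h : ∀ᵐ t, t ∈ Ioo a (a + δ) → W t = p t) :
    Tendsto (fun h : ℝ => h⁻¹ • ∫ t in a..(a + h), W t) (𝓝[>] 0) (𝓝 (p a)) := by
  have d := (hp.integral_hasStrictDerivAt a a).hasDerivAt
  rw [hasDerivAt_iff_tendsto_slope_zero] at d
  simp only [intervalIntegral.integral_same, sub_zero] at d
  refine (d.mono_left (nhdsWithin_mono 0 fun h (hh : 0 < h) => ne_of_gt hh)).congr' ?_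
  filter_upwards [Ioo_mem_nhdsGT hδ] with r hr
  congr 1
  refine intervalIntegral.integral_congr_ae ?_
  filter_upwards [h] with t ht hmem
  rw [uIoc_of_le (by linarith [hr.1])] at hmem
  exact (ht ⟨hmem.1, by linarith [hmem.2, hr.2]⟩).symm

/-- The difference quotients of a trajectory, tested against a smooth function. -/
theorem tendsto_integral_slope (W : LineL2 X) {φ : ℝ → ℝ} (hφ : ContDiff ℝ (⊤ : ℕ∞) φ)
    (hs : tsupport φ ⊆ Ioo (-1) 0) (hc : HasCompactSupport φ) :
    Tendsto (fun h : ℝ => ∫ σ in Icc (-1 : ℝ) 0, φ σ • h⁻¹ • (W (σ + h) - W σ)) (𝓝[>] 0)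
      (𝓝 (-∫ σ in Icc (-1 : ℝ) 0, deriv φ σ • W σ)) := by
  have hz : ∀ σ, σ ∉ Ioo (-1 : ℝ) 0 → φ σ = 0 := fun σ hσ => by
    by_contra h
    exact hσ (hs (subset_tsupport φ h))
  have hz' : ∀ σ, σ ∉ Ioo (-1 : ℝ) 0 → deriv φ σ = 0 := fun σ hσ => by
    by_contra h
    exact hσ (hs (support_deriv_subset h))
  have hloc : LocallyIntegrable W volume := (Lp.memLp W).locallyIntegrable (by norm_num)
  have hint : ∀ {ψ : ℝ → ℝ}, Continuous ψ → HasCompactSupport ψ →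
      Integrable fun σ => ψ σ • W σ := fun hψ hψc =>
    hloc.integrable_smul_left_of_hasCompactSupport hψ hψc
  have hlocs : ∀ a, LocallyIntegrable (fun σ => W (σ + a)) volume := fun a =>
    ((Lp.memLp W).comp_measurePreserving
      (measurePreserving_add_right volume a)).locallyIntegrable (by norm_num)
  -- Discrete integration by parts: translation moves the difference quotient from `W`, which has no
  -- regularity, to `φ`.
  have e : ∀ h : ℝ, ∫ σ in Icc (-1 : ℝ) 0, φ σ • h⁻¹ • (W (σ + h) - W σ) =
      ∫ σ, (h⁻¹ * (φ (σ - h) - φ σ)) • W σ := fun h => by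
    have hci : HasCompactSupport fun σ => φ (σ - h) := hc.comp_homeomorph (Homeomorph.subRight h)
    have hcc : Continuous fun σ => φ (σ - h) := hφ.continuous.comp (by fun_prop)
    rw [setIntegral_eq_integral_of_forall_compl_eq_zero fun σ hσ => by
      rw [hz σ fun h => hσ (Ioo_subset_Icc_self h), zero_smul]]
    simp only [mul_smul, sub_smul, smul_comm _ h⁻¹, smul_sub]
    rw [integral_sub, integral_sub, integral_smul, integral_smul, integral_smul]
    · congr 2
      rw [← integral_add_right_eq_self (fun σ => φ (σ - h) • W σ) h]
      simp only [add_sub_cancel_right]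
    · exact (hint hcc hci).smul _
    · exact (hint hφ.continuous hc).smul _
    · exact ((hlocs h).integrable_smul_left_of_hasCompactSupport hφ.continuous hc).smul _
    · exact (hint hφ.continuous hc).smul _
  simp only [e]
  have e' : -∫ σ in Icc (-1 : ℝ) 0, deriv φ σ • W σ = ∫ σ, (-deriv φ σ) • W σ := by
    rw [setIntegral_eq_integral_of_forall_compl_eq_zero fun σ hσ => by
      rw [hz' σ fun h => hσ (Ioo_subset_Icc_self h), zero_smul], ← integral_neg]
    simp only [neg_smul]
  rw [e']
  obtain ⟨K, hK⟩ := ContDiff.lipschitzWith_of_hasCompactSupport hc hφ (by simp)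
  -- The quotients of `φ` are bounded by its Lipschitz constant, and for `0 < h < 1` they are
  -- supported in `[-1, 1]`, where `W` is integrable.
  refine tendsto_integral_filter_of_dominated_convergence
    ((Icc (-1 : ℝ) 1).indicator fun σ => K * ‖W σ‖) ?_ ?_ ?_ ?_
  · refine Eventually.of_forall fun h => ?_
    exact (by fun_prop : Continuous fun σ => h⁻¹ * (φ (σ - h) - φ σ)).aestronglyMeasurable.smul
      (Lp.aestronglyMeasurable W)
  · filter_upwards [Ioo_mem_nhdsGT one_pos] with h hh
    refine Eventually.of_forall fun σ => ?_
    by_cases hσ : σ ∈ Icc (-1 : ℝ) 1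
    · rw [indicator_of_mem hσ, norm_smul]
      gcongr
      rw [norm_mul, norm_inv, Real.norm_of_nonneg hh.1.le]
      rw [inv_mul_le_iff₀ hh.1]
      have := hK.dist_le_mul (σ - h) σ
      rw [dist_eq_norm, dist_eq_norm, sub_sub_cancel_left, norm_neg,
        Real.norm_of_nonneg hh.1.le] at this
      linarith
    · rw [indicator_of_notMem hσ, hz σ fun h' => hσ ⟨h'.1.le, by linarith [h'.2]⟩,
        hz (σ - h) fun h' => hσ ⟨by linarith [h'.1, hh.1], by linarith [h'.2, hh.2]⟩]
      simp
  · rw [integrable_indicator_iff measurableSet_Icc]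
    exact ((hloc.integrableOn_isCompact isCompact_Icc).norm.const_mul _)
  · refine Eventually.of_forall fun σ => ?_
    have d : HasDerivAt (fun h => φ (σ - h)) (-deriv φ σ) 0 := by
      have d0 : HasDerivAt φ (deriv φ σ) (σ - 0) := by
        rw [sub_zero]
        exact (hφ.differentiable (by simp)).differentiableAt.hasDerivAt
      simpa using d0.comp_const_sub σ 0
    rw [hasDerivAt_iff_tendsto_slope_zero] at d
    simp only [zero_add, sub_zero, smul_eq_mul] at d
    exact (d.mono_left (nhdsWithin_mono 0 fun h (hh : 0 < h) => ne_of_gt hh)).smul_const (W σ)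

end HistoryCalculus

/-! ### Identification of the generator with the delay operator. -/

section DelayGenerator

variable {X : Type*} [NormedAddCommGroup X] [NormedSpace ℂ X] [CompleteSpace X]
  {S : C0Semigroup X} {M ω : ℝ} {C : X →L[ℂ] X}
  {U : DelaySpace X →L[ℂ] LineL2 X} {T : C0Semigroup (DelaySpace X)}

omit [CompleteSpace X] in
theorem coeFn_history_slope (hU : ∀ v, IsTrajectory S C v (U v))
    (hT : ∀ t ≥ 0, ∀ v, (T.op t v).fst = S.op t v.fst + conv S (delayed C (U v)) t ∧
      (T.op t v).snd = restr X (Icc (-1) 0) (transl X t (U v))) (v : DelaySpace X) {h : ℝ}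
    (hh : 0 ≤ h) :
    (h⁻¹ • ((T.op h v).snd - v.snd) : HistL2 X) =ᵐ[histMeasure]
      fun σ => h⁻¹ • (U v (σ + h) - U v σ) := by
  rw [(hT h hh v).2]
  filter_upwards [Lp.coeFn_smul h⁻¹ (restr X (Icc (-1) 0) (transl X h (U v)) - v.snd),
    Lp.coeFn_sub (restr X (Icc (-1) 0) (transl X h (U v))) v.snd,
    coeFn_restr (Icc (-1) 0) (transl X h (U v)), ae_restrict_of_ae (coeFn_transl h (U v)),
    (ae_restrict_iff' measurableSet_Icc).2 (hU v).history] with σ h1 h2 h3 h4 h5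
  rw [h1, Pi.smul_apply, h2, Pi.sub_apply, h3, h4, h5]

/-- The delay term of the variation of constants formula is differentiable at time zero. -/
theorem tendsto_conv_delayed {W : LineL2 X} (hpast : ∀ᵐ t, t < -1 → W t = 0) {p : ℝ → X}
    (hp : Continuous p) (hW : ∀ᵐ t, t ∈ Icc (-1 : ℝ) 0 → W t = p t) :
    Tendsto (fun h : ℝ => h⁻¹ • conv S (delayed C W) h) (𝓝[>] 0) (𝓝 (C (p (-1)))) := by
  -- The substitution `r = hρ` turns the average over `(0, h)` into an integral over `[0, 1]`
  -- depending continuously on `h`, also at `h = 0`.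
  have hcont : Continuous fun q : ℝ × ℝ => S.op (q.1 * q.2) (C (p (q.1 - q.1 * q.2 - 1))) :=
    S.continuous_op.comp ((continuous_fst.mul continuous_snd).prodMk
      (C.continuous.comp (hp.comp (by fun_prop))))
  have hlim := (intervalIntegral.continuous_parametric_intervalIntegral_of_continuous' (μ := volume)
    (f := fun h ρ => S.op (h * ρ) (C (p (h - h * ρ - 1)))) hcont 0 1).tendsto 0
  simp only [zero_mul, sub_zero, zero_sub, S.op_zero_apply, intervalIntegral.integral_const,
    one_smul] at hlim
  refine (hlim.mono_left nhdsWithin_le_nhds).congr' ?_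
  filter_upwards [Ioo_mem_nhdsGT one_pos] with h hh
  rw [intervalIntegral.integral_comp_mul_left (fun r => S.op r (C (p (h - r - 1)))) hh.1.ne',
    mul_zero, mul_one, intervalIntegral.integral_of_le hh.1.le, integral_Ioc_eq_integral_Ioo]
  congr 1
  -- For `r > h` the delayed input is still zero; for `0 < r < h < 1` it reads only the history,
  -- where `W` equals `p`.
  have e0 : ∫ r in Ioi (0 : ℝ), S.op r (delayed C W (h - r)) =
      ∫ r in Ioo 0 h, S.op r (delayed C W (h - r)) := by
    rw [← integral_Ioc_eq_integral_Ioo]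
    refine setIntegral_eq_of_subset_of_ae_sdiff_eq_zero measurableSet_Ioi.nullMeasurableSet
      Ioc_subset_Ioi_self ?_
    filter_upwards [ae_comp_sub_left (delayed_eq_zero (C := C) hpast) h] with r hr hmem
    have : h < r := not_le.1 fun hle => hmem.2 (mem_Ioc.2 ⟨hmem.1, hle⟩)
    rw [hr (by linarith), map_zero]
  rw [conv, e0]
  refine setIntegral_congr_ae measurableSet_Ioo ?_
  filter_upwards [ae_comp_sub_left (coeFn_delayed C W) h,
    ae_comp_sub_left (ae_comp_add hW (-1)) h] with r h1 h2 hr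
  rw [h1, sub_eq_add_neg (h - r) 1, h2 ⟨by linarith [hr.2], by linarith [hr.1, hh.2]⟩]

/-- The generator of the delay semigroup is contained in the delay operator. -/
theorem hasGenValue_delaySemigroup (hM : ∀ t ≥ 0, ‖S.op t‖ ≤ M * Real.exp (ω * t)) (hω : ω < 0)
    (hU : ∀ v, IsTrajectory S C v (U v))
    (hT : ∀ t ≥ 0, ∀ v, (T.op t v).fst = S.op t v.fst + conv S (delayed C (U v)) t ∧
      (T.op t v).snd = restr X (Icc (-1) 0) (transl X t (U v))) {v w : DelaySpace X}
    (hvw : T.HasGenValue v w) :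
    ∃ h : v ∈ delayDomain S.generator,
      delayOperator S.generator (pointDelay C) ⟨v, h⟩ = w := by
  have hq := C0Semigroup.hasGenValue_iff.1 hvw
  set W := U v with hWdef
  have hq1 : Tendsto (fun h : ℝ => h⁻¹ • ((T.op h v).fst - v.fst)) (𝓝[>] 0) (𝓝 w.fst) :=
    ((WithLp.fstL 2 ℂ X (HistL2 X)).continuous.tendsto w).comp hq
  have hq2 : Tendsto (fun h : ℝ => (h⁻¹ • ((T.op h v).snd - v.snd) : HistL2 X)) (𝓝[>] 0)
      (𝓝 w.snd) :=
    ((WithLp.sndL 2 ℂ X (HistL2 X)).continuous.tendsto w).comp hq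
  have htest : ∀ φ : ℝ → ℝ, Continuous φ →
      Tendsto (fun h : ℝ => ∫ σ in Icc (-1 : ℝ) 0, φ σ • h⁻¹ • (W (σ + h) - W σ)) (𝓝[>] 0)
        (𝓝 (∫ σ in Icc (-1 : ℝ) 0, φ σ • w.snd σ)) := fun φ hφ => by
    refine (tendsto_integral_smul_hist hq2 hφ).congr' ?_
    filter_upwards [self_mem_nhdsWithin] with h hh
    refine integral_congr_ae ?_
    filter_upwards [coeFn_history_slope hU hT v (le_of_lt hh)] with σ hσ
    rw [hσ]
  have hhist : v.snd =ᵐ[histMeasure] W := by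
    filter_upwards [(ae_restrict_iff' measurableSet_Icc).2 (hU v).history] with σ hσ
    exact hσ.symm
  have hweak : IsWeakDeriv v.snd w.snd := by
    intro φ hφ hc hs
    -- The tested quotients converge both to `∫ φ w₂`, with `w₂` the second component of `w`, and to
    -- `-∫ φ' W`.
    have h1 := tendsto_nhds_unique (htest φ hφ.continuous) (tendsto_integral_slope W hφ hs hc)
    rw [h1, neg_neg]
    refine integral_congr_ae ?_
    filter_upwards [hhist] with σ hσ
    rw [hσ]
  have hmem : v.snd ∈ W12 X := ⟨w.snd, hweak⟩
  obtain ⟨c, hrep⟩ := hweak.exists_isContRep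
  set F : ℝ → X := fun σ => c + ∫ s in (-1)..σ, w.snd s with hF
  set p : ℝ → X := IccExtend (by norm_num : (-1 : ℝ) ≤ 0) ((Icc (-1 : ℝ) 0).domRestrict F) with hp
  have hpF : ∀ σ ∈ Icc (-1 : ℝ) 0, p σ = F σ := fun σ hσ => by
    rw [hp, IccExtend_of_mem _ _ hσ, domRestrict_apply]
  have hpc : Continuous p := (continuousOn_iff_continuous_domRestrict.1 hrep.1).Icc_extend'
  have hWp : ∀ᵐ t, t ∈ Icc (-1 : ℝ) 0 → W t = p t := by
    filter_upwards [(ae_restrict_iff' measurableSet_Icc).1 (hhist.symm.trans hrep.2)] with t ht hm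
    rw [ht hm, hpF t hm]
  have hF1 : F (-1) = c := by rw [hF]; simp
  have hp1 : p (-1) = c := by rw [hpF _ (by norm_num), hF1]
  have hfut : ∀ᵐ t, t ∈ Ioo (0 : ℝ) (0 + 1) →
      W t = S.op t v.fst + conv S (delayed C W) t := by
    filter_upwards [(hU v).future] with t ht hm
    exact ht hm.1
  have hucont : Continuous fun t => S.op t v.fst + conv S (delayed C W) t :=
    (S.continuous_op_apply _).add (continuous_conv hM hω _)
  have hWi : ∀ a b : ℝ, IntervalIntegrable W volume a b := fun a b =>
    (((Lp.memLp W).locallyIntegrable (by norm_num)).integrableOn_isCompact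
      isCompact_uIcc).intervalIntegrable
  have hx : F 0 = v.fst := by
    -- Testing with `1` detects the boundary: the integrated quotient is the average of `W` over
    -- `(0, h)` minus that over `(-1, -1 + h)`, with limit `x - F(-1)`. The other limit is `∫ w₂ =
    -- F(0) - F(-1)`, hence `F(0) = x`.
    have h1 := htest (fun _ => 1) continuous_const
    have h2 := (tendsto_average hucont one_pos hfut).sub
      (tendsto_average (a := -1) hpc one_pos (W := W) (by
        filter_upwards [hWp] with t ht hm
        exact ht ⟨hm.1.le, by linarith [hm.2]⟩))
    rw [hp1, S.op_zero_apply, conv_eq_zero (delayed_eq_zero (hU v).past) le_rfl, add_zero] at h2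
    have h3 : v.fst - c = ∫ σ in Icc (-1 : ℝ) 0, (1 : ℝ) • w.snd σ := by
      refine tendsto_nhds_unique (h2.congr fun h => ?_) h1
      have hWs : IntervalIntegrable (fun σ => W (σ + h)) volume (-1) 0 := by
        have := (hWi (-1 + h) (0 + h)).comp_add_right h
        simpa using this
      simp only [one_smul]
      rw [integral_Icc_eq_integral_Ioc, ← intervalIntegral.integral_of_le (by norm_num),
        intervalIntegral.integral_smul, intervalIntegral.integral_sub hWs (hWi _ _),
        intervalIntegral.integral_comp_add_right, ← smul_sub,
        intervalIntegral.integral_interval_sub_interval_comm' (hWi _ _) (hWi _ _) (hWi _ _)]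
    have h4 : F 0 = c + ∫ σ in Icc (-1 : ℝ) 0, (1 : ℝ) • w.snd σ := by
      simp only [one_smul]
      rw [integral_Icc_eq_integral_Ioc, ← intervalIntegral.integral_of_le (by norm_num)]
    rw [h4, ← h3, add_sub_cancel]
  have hpast1 : pointEval ⟨-1, by norm_num⟩ ⟨v.snd, hmem⟩ = c :=
    (pointEval_eq (f := ⟨v.snd, hmem⟩) hrep _).trans hF1
  have hgen : S.HasGenValue v.fst (w.fst - C c) := by
    rw [C0Semigroup.hasGenValue_iff]
    -- Removing the delay term, whose derivative at zero is `C c`, leaves the difference quotient of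
    -- `S` alone.
    have h1 := hq1.sub (tendsto_conv_delayed (S := S) (C := C) (hU v).past hpc hWp)
    rw [hp1] at h1
    refine h1.congr' ?_
    filter_upwards [self_mem_nhdsWithin] with h hh
    rw [(hT h (le_of_lt hh) v).1, ← smul_sub]
    congr 1
    abel
  have hdom : v ∈ delayDomain S.generator :=
    ⟨hgen.mem_domain, hmem, (pointEval_eq (f := ⟨v.snd, hmem⟩) hrep _).trans hx⟩
  refine ⟨hdom, ?_⟩
  refine (delayOperator_apply _ _ _).trans (WithLp.ofLp_injective 2 (Prod.ext ?_ ?_))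
  · change S.generator ⟨v.fst, _⟩ + C (pointEval ⟨-1, _⟩ ⟨v.snd, hmem⟩) = w.fst
    rw [C0Semigroup.generator_apply_eq hgen, hpast1, sub_add_cancel]
  · exact weakDeriv_eq (f := ⟨v.snd, hmem⟩) hweak

/-- The history component of an eigenvector of the delay operator is an exponential. -/
theorem exp_smul_pointEval {f : W12 X} {l : ℝ} (hf : weakDeriv f = (l : ℂ) • (f : HistL2 X)) :
    (f : HistL2 X) =ᵐ[histMeasure]
        (fun σ => Real.exp (l * σ) • pointEval ⟨0, by norm_num⟩ f) ∧
      pointEval ⟨-1, by norm_num⟩ f = Real.exp (-l) • pointEval ⟨0, by norm_num⟩ f := by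
  have hweak := isWeakDeriv_weakDeriv f
  obtain ⟨c, hrep⟩ := hweak.exists_isContRep
  set F : ℝ → X := fun σ => c + ∫ s in (-1)..σ, weakDeriv f s with hF
  set p : ℝ → X := IccExtend (by norm_num : (-1 : ℝ) ≤ 0) ((Icc (-1 : ℝ) 0).domRestrict F) with hp
  have hpF : ∀ σ ∈ Icc (-1 : ℝ) 0, p σ = F σ := fun σ hσ => by
    rw [hp, IccExtend_of_mem _ _ hσ, domRestrict_apply]
  have hpc : Continuous p := (continuousOn_iff_continuous_domRestrict.1 hrep.1).Icc_extend'
  have hFp : ∀ σ ∈ Icc (-1 : ℝ) 0, F σ = c + ∫ s in (-1)..σ, l • p s := fun σ hσ => by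
    rw [hF]
    simp only
    congr 1
    refine intervalIntegral.integral_congr_ae ?_
    have h1 : weakDeriv f =ᵐ[histMeasure] fun s => l • p s := by
      rw [hf]
      filter_upwards [Lp.coeFn_smul (l : ℂ) (f : HistL2 X), hrep.2,
        ae_restrict_mem measurableSet_Icc] with s k1 k2 k3
      rw [k1, Pi.smul_apply, k2, hpF s k3, Complex.coe_smul]
    filter_upwards [(ae_restrict_iff' measurableSet_Icc).1 h1] with s hs hm
    rw [uIoc_of_le hσ.1] at hm
    exact hs ⟨hm.1.le, hm.2.trans hσ.2⟩
  -- `F' = l F` on the interval, so `e^{-lσ} F` is constant. Integrating the continuous extension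
  -- `p` makes `G` differentiable at every real point.
  set G : ℝ → X := fun σ => Real.exp (-(l * σ)) • (c + ∫ s in (-1)..σ, l • p s) with hG
  have hlp : Continuous fun s => l • p s := hpc.const_smul l
  have hGd : ∀ σ, HasDerivAt G (Real.exp (-(l * σ)) • (l • p σ) +
      (Real.exp (-(l * σ)) * -(l * 1)) • (c + ∫ s in (-1)..σ, l • p s)) σ := fun σ =>
    (((hasDerivAt_id σ).const_mul l).neg.exp).smul
      ((hlp.integral_hasStrictDerivAt (-1) σ).hasDerivAt.const_add c)
  have hconst : ∀ σ ∈ Icc (-1 : ℝ) 0, G σ = G (-1) := by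
    refine constant_of_has_deriv_right_zero
      (fun σ _ => (hGd σ).continuousAt.continuousWithinAt) fun σ hσ => ?_
    have hσ' : σ ∈ Icc (-1 : ℝ) 0 := ⟨hσ.1, hσ.2.le⟩
    have h := (hGd σ).hasDerivWithinAt (s := Ici σ)
    rw [← hFp σ hσ', ← hpF σ hσ', smul_smul, ← add_smul] at h
    convert h using 1
    rw [mul_one, mul_neg, add_neg_cancel, zero_smul]
  have hFG : ∀ σ ∈ Icc (-1 : ℝ) 0, F σ = Real.exp (l * σ) • F 0 := fun σ hσ => by
    have h1 := (hconst σ hσ).trans (hconst 0 (by norm_num)).symm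
    simp only [hG] at h1
    rw [← hFp σ hσ, ← hFp 0 (by norm_num), mul_zero, neg_zero, Real.exp_zero, one_smul] at h1
    rw [← h1, smul_smul, ← Real.exp_add, add_neg_cancel, Real.exp_zero, one_smul]
  have e0 : pointEval ⟨0, by norm_num⟩ f = F 0 := pointEval_eq hrep _
  have e1 : pointEval ⟨-1, by norm_num⟩ f = F (-1) := pointEval_eq hrep _
  refine ⟨?_, ?_⟩
  · filter_upwards [hrep.2, ae_restrict_mem measurableSet_Icc] with σ h1 h2
    rw [h1, e0, hFG σ h2]
  · rw [e0, e1, hFG (-1) (by norm_num), mul_neg, mul_one]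

/-- Large real numbers are not eigenvalues of the delay operator. -/
theorem delayOperator_injective (hM : ∀ t ≥ 0, ‖S.op t‖ ≤ M * Real.exp (ω * t)) (hω : ω < 0)
    {l : ℝ} (hl : M * ‖C‖ < l) (v : delayDomain S.generator)
    (hv : delayOperator S.generator (pointDelay C) v = (l : ℂ) • (v : DelaySpace X)) :
    v = 0 := by
  have hM0 : 0 ≤ M := by simpa using (norm_nonneg _).trans (hM 0 le_rfl)
  have hl0 : 0 < l := (mul_nonneg hM0 (norm_nonneg _)).trans_lt hl
  rw [delayOperator_apply] at hv
  have hv1 : S.generator (delayFst S.generator v) + pointDelay C (delaySnd S.generator v) =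
      (l : ℂ) • (v : DelaySpace X).fst := congrArg WithLp.fst hv
  have hv2 : weakDeriv (delaySnd S.generator v) = (l : ℂ) • (v : DelaySpace X).snd :=
    congrArg WithLp.snd hv
  have htr : pointEval ⟨0, by norm_num⟩ (delaySnd S.generator v) = (v : DelaySpace X).fst :=
    v.2.2.2
  obtain ⟨h1, h2⟩ := exp_smul_pointEval (f := delaySnd S.generator v) hv2
  rw [htr] at h1 h2
  set x := (v : DelaySpace X).fst with hx
  have hz : ω < (l : ℂ).re := by simpa using hω.trans hl0
  have hR := (C0Semigroup.isResolventAt_laplace hM hz).2 (delayFst S.generator v)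
  -- The first component of the eigenvalue equation is the fixed point equation `x = R(l, B) C
  -- e^{-l} x`; with `‖R(l, B)‖ ≤ M / (l - ω)` and `M ‖C‖ < l` the right side is a strict
  -- contraction.
  have hR' : S.laplace hM hz (C (Real.exp (-l) • x)) = x := by
    rw [← h2]
    refine Eq.trans (congrArg _ ?_) hR
    exact (sub_eq_of_eq_add' hv1.symm).symm
  have hx0 : x = 0 := by
    by_contra hne
    have hpos : 0 < ‖x‖ := norm_pos_iff.2 hne
    have b : ‖x‖ ≤ M * (l - ω)⁻¹ * (‖C‖ * ‖x‖) := by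
      conv_lhs => rw [← hR']
      refine (S.laplace hM hz).le_of_opNorm_le_of_le (by
        simpa using C0Semigroup.norm_laplace_le hM hz hM0) (C.le_of_opNorm_le_of_le le_rfl ?_)
      rw [norm_smul, Real.norm_of_nonneg (Real.exp_pos _).le]
      exact mul_le_of_le_one_left (norm_nonneg _) (Real.exp_le_one_iff.2 (by linarith))
    have hlw : 0 < l - ω := by linarith
    have b2 : (l - ω) * ‖x‖ ≤ M * ‖C‖ * ‖x‖ := by
      calc (l - ω) * ‖x‖ ≤ (l - ω) * (M * (l - ω)⁻¹ * (‖C‖ * ‖x‖)) := by gcongr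
        _ = M * ‖C‖ * ‖x‖ := by field_simp
    have := le_of_mul_le_mul_right b2 hpos
    linarith
  refine Subtype.ext (WithLp.ofLp_injective 2 (Prod.ext hx0 (Lp.ext ?_)))
  filter_upwards [h1, Lp.coeFn_zero X 2 histMeasure] with σ k1 k2
  refine (k1.trans ?_).trans k2.symm
  rw [hx0, smul_zero, Pi.zero_apply]

/-- The delay operator generates the delay semigroup. -/
theorem generator_delaySemigroup (hM : ∀ t ≥ 0, ‖S.op t‖ ≤ M * Real.exp (ω * t)) (hω : ω < 0)
    (hU : ∀ v, IsTrajectory S C v (U v))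
    (hT : ∀ t ≥ 0, ∀ v, (T.op t v).fst = S.op t v.fst + conv S (delayed C (U v)) t ∧
      (T.op t v).snd = restr X (Icc (-1) 0) (transl X t (U v))) :
    T.generator = delayOperator S.generator (pointDelay C) := by
  set A := delayOperator S.generator (pointDelay C) with hA
  have hle : T.generator ≤ A := by
    refine ⟨fun v hv => ?_, fun v w hvw => ?_⟩
    · exact (hasGenValue_delaySemigroup hM hω hU hT
        (C0Semigroup.hasGenValue_generator ⟨v, hv⟩)).1
    · obtain ⟨h, e⟩ := hasGenValue_delaySemigroup hM hω hU hT
        (C0Semigroup.hasGenValue_generator v)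
      rw [← e]
      exact congrArg A (Subtype.ext hvw)
  -- A surjective operator has no proper injective extension: solve the resolvent equation with the
  -- same right-hand side in the smaller domain and compare. The delay semigroup is bounded, so any
  -- `l > 0` lies in the resolvent set of its generator.
  refine LinearPMap.eq_of_le_of_domain_eq hle (le_antisymm hle.1 fun v hv => ?_)
  obtain ⟨L, hL⟩ := exists_norm_delaySemigroup_le hM hω hT
  have hM0 : 0 ≤ M := by simpa using (norm_nonneg _).trans (hM 0 le_rfl)
  have hL' : ∀ t ≥ 0, ‖T.op t‖ ≤ L * Real.exp (0 * t) := by simpa using hL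
  set l : ℝ := M * ‖C‖ + 1 with hl
  have hz : (0 : ℝ) < (l : ℂ).re := by
    rw [Complex.ofReal_re]
    positivity
  obtain ⟨hm, hres⟩ :=
    (C0Semigroup.isResolventAt_laplace hL' hz).1 ((l : ℂ) • v - A ⟨v, hv⟩)
  set w := T.laplace hL' hz ((l : ℂ) • v - A ⟨v, hv⟩) with hw
  have hAw : T.generator ⟨w, hm⟩ = A ⟨w, hle.1 hm⟩ := hle.2 rfl
  have h0 : (⟨v, hv⟩ - ⟨w, hle.1 hm⟩ : A.domain) = 0 := by
    refine delayOperator_injective (C := C) (l := l) hM hω (lt_add_one _) _ ?_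
    change A (⟨v, hv⟩ - ⟨w, hle.1 hm⟩) = (l : ℂ) • (v - w)
    rw [LinearPMap.map_sub, ← hAw, smul_sub]
    rw [sub_eq_sub_iff_add_eq_add] at hres
    rw [sub_eq_sub_iff_add_eq_add, add_comm, hres, add_comm]
  have hvw : v = w := congrArg Subtype.val (sub_eq_zero.1 h0)
  rw [hvw]
  exact hm

end DelayGenerator

/-- The resolvent of the generator of an exponentially stable semigroup is bounded on the imaginary
axis. -/
theorem iSup_resolventOp_lt_top {X : Type*} [NormedAddCommGroup X] [NormedSpace ℂ X]
    [CompleteSpace X] {S : C0Semigroup X} {M ω : ℝ}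
    (hM : ∀ t ≥ 0, ‖S.op t‖ ≤ M * Real.exp (ω * t)) (hω : ω < 0) :
    ⨆ s : ℝ, ‖resolventOp S.generator (Complex.I * (s : ℂ))‖ₑ < ⊤ := by
  have hM0 : 0 ≤ M := by simpa using (norm_nonneg _).trans (hM 0 le_rfl)
  refine (iSup_le fun s => ?_).trans_lt (ENNReal.ofReal_lt_top (r := M * (0 - ω)⁻¹))
  have hz : ω < (Complex.I * (s : ℂ)).re := by simpa using hω
  rw [(C0Semigroup.isResolventAt_laplace hM hz).resolventOp_eq, ← ofReal_norm]
  refine ENNReal.ofReal_le_ofReal ?_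
  simpa using C0Semigroup.norm_laplace_le hM hz hM0

end DelayEq

end

theorem mainTheorem5 {X : Type*} [NormedAddCommGroup X] [InnerProductSpace ℂ X]
    [CompleteSpace X] (B : X →ₗ.[ℂ] X) (S : DelayEq.C0Semigroup X) (hB : S.generator = B)
    (hS : S.growthBound < 0) (C : X →L[ℂ] X) (hC : DelayEq.CommutesWith C B)
    (hr : spectralRadius ℂ C <
      1 / ⨆ ω : ℝ, ‖DelayEq.resolventOp B (Complex.I * (ω : ℂ))‖ₑ) :
    ∃ T : DelayEq.C0Semigroup (DelayEq.DelaySpace X),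
      T.generator = DelayEq.delayOperator B (DelayEq.pointDelay C) ∧ T.growthBound < 0 := by
  subst hB
  obtain ⟨M, ω, hω, hM⟩ := DelayEq.C0Semigroup.exists_exp_bound hS
  have htop := DelayEq.iSup_resolventOp_lt_top hM hω
  -- The supremum is finite by stability, so it can serve as a real bound for the norm of the
  -- convolution operator.
  set m := (⨆ ω : ℝ, ‖DelayEq.resolventOp S.generator (Complex.I * (ω : ℂ))‖ₑ).toNNReal with hm
  have hmc := ENNReal.coe_toNNReal htop.ne
  rw [← hmc] at hr
  have hmb : ∀ s : ℝ, ‖DelayEq.resolventOp S.generator (Complex.I * (s : ℂ))‖ ≤ m := fun s => by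
    have h := le_iSup (fun s : ℝ => ‖DelayEq.resolventOp S.generator (Complex.I * (s : ℂ))‖ₑ) s
    rw [← hmc, enorm_eq_nnnorm, ENNReal.coe_le_coe] at h
    exact h
  obtain ⟨K, hKm, hK⟩ := DelayEq.exists_convOp hM hω hmb
  have hsum := DelayEq.summable_delay_pow hM hω (fun t ht x => hC.op_comm hM ht x) hK hKm hr
  obtain ⟨U, hU, huniq⟩ := DelayEq.exists_trajectory hM hω hK hsum
  obtain ⟨T, hT⟩ := DelayEq.exists_delaySemigroup hM hω hU huniq
  exact ⟨T, DelayEq.generator_delaySemigroup hM hω hU hT,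
    DelayEq.growthBound_delaySemigroup_neg hM hω hU hT⟩
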